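/- **Setting.** Fix $\delta\in(0,1/2)$, $\lambda_0>0$ and a nonnegative $\phi\in C_c^\infty(\mathbb R^2)$ whose support is contained in $[-\delta,\delta]^2$. On a probability space $(\Omega,\mathcal F,\mathbb P)$ let $l(i,j)$, $(i,j)\in\mathbb Z\times(\mathbb Z+\tfrac12)$, be i.i.d. exponential random variables with $\mathbb P\{l(i,j)>r\}=e^{-\lambda_0 r}$ for $r\ge 0$, and let $$f(x,s,\omega)=g(x,s,\omega)-\sum_{(i,j)\in\mathbb Z\times(\mathbb Z+1/2)} l(i,j)(\omega)\,\phi\big((x,s)-(i,j)\big),$$ where $g\ge 0$ is of class $C^1$ in $(x,s)$ and is such that almost surely $\lim_{L\to\infty}(2L)^{-2}\int_{[-L,L]^2}f(x,s,\omega)\,dx\,ds=0$. **Theorem 2.1.** There exist $F_0>0$, $C>0$, $K>0$ and $N_0\in\mathbb N$, depending only on $\delta$, $\lambda_0$ and $\phi$, such that for all $F>F_0$ and all integers $N\ge N_0$ there is an event $E\in\mathcal F$ with $$\mathbb P(E)\ \ge\ 1-C e^{-N/C}$$ such that for every $\omega\in E$, every classical solution $u$ of $$u_{xx}+f(x,u,\omega)+F=0\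 \text{ in }[-N+\delta,N-\delta],\qquad u(-N+\delta)=u(N-\delta)=0,$$ satisfies $u(x)\ge (K(N-1)-K|x|)_+$ for all $x\in[-N+\delta,N-\delta]$, where $a_+=\max(a,0)$. -/

import Mathlib

open MeasureTheory ProbabilityTheory Set Filter Topology

/-- The closed square `Q_δ(0,0) = [-δ, δ]²`. -/
def obstacleSquare (δ : ℝ) : Set (ℝ × ℝ) := Icc (-δ) δ ×ˢ Icc (-δ) δ

/-- An obstacle profile: a smooth nonnegative function supported in `[-δ, δ]²`. -/
structure IsObstacleProfile (δ : ℝ) (φ : ℝ × ℝ → ℝ) : Prop where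
  smooth : ContDiff ℝ ((⊤ : ℕ∞) : WithTop ℕ∞) φ
  nonneg : ∀ z, 0 ≤ φ z
  support_subset : Function.support φ ⊆ obstacleSquare δ

/-- The nodes of the lattice `ℤ × (ℤ + 1/2)`; the index `(i, j) ∈ ℤ × ℤ` stands for the
node `(i, j + 1/2)`. -/
noncomputable def latticeNode (p : ℤ × ℤ) : ℝ × ℝ := ((p.1 : ℝ), (p.2 : ℝ) + 1 / 2)

/-- The family `l` consists of independent exponential random variables of parameter `lam`. -/
structure IsIIDExponential {Ω : Type*} [MeasurableSpace Ω] (P : Measure Ω) (lam : ℝ)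
    (l : ℤ × ℤ → Ω → ℝ) : Prop where
  measurable : ∀ p, Measurable (l p)
  indep : iIndepFun l P
  tail : ∀ p, ∀ r : ℝ, 0 ≤ r → P {ω | r < l p ω} = ENNReal.ofReal (Real.exp (-lam * r))

/-- The field `f(x, s) = g(x, s) - ∑ l(i,j) φ((x, s) - b_{i,j})` for one realisation of the
obstacle strengths. At every `(x, s)` only finitely many terms of the sum are nonzero. -/
noncomputable def obstacleField (φ : ℝ × ℝ → ℝ) (g : ℝ × ℝ → ℝ) (l : ℤ × ℤ → ℝ)
    (x s : ℝ) : ℝ :=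
  g (x, s) - ∑' p : ℤ × ℤ, l p * φ ((x, s) - latticeNode p)

/-- Spatial mean zero: the averages of `f` over the squares `[-L, L]²` tend to zero. -/
def HasMeanZero (f : ℝ → ℝ → ℝ) : Prop :=
  Tendsto (fun L : ℝ => ((2 * L) ^ 2)⁻¹ * ∫ z in Icc (-L) L ×ˢ Icc (-L) L, f z.1 z.2)
    atTop (𝓝 0)

/-- A compensating field: the nonnegative `C¹` part `g` of the random field, which gives the
field mean zero almost surely. (A deterministic `g` is the case of a constant family.) -/
structure IsCompensator {Ω : Type*} [MeasurableSpace Ω] (P : Measure Ω) (φ : ℝ × ℝ → ℝ)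
    (l : ℤ × ℤ → Ω → ℝ) (g : Ω → ℝ × ℝ → ℝ) : Prop where
  contDiff : ∀ ω, ContDiff ℝ 1 (g ω)
  nonneg : ∀ ω z, 0 ≤ g ω z
  meanZero : ∀ᵐ ω ∂P, HasMeanZero (obstacleField φ (g ω) (fun p => l p ω))

/-- Classical solutions of the Dirichlet problem `u_xx + f(x, u) + F = 0` on `[a, b]` with
`u(a) = u(b) = 0`. For continuous `f` the second derivative of such a `u` extends
continuously to the endpoints, and the equation holds there as well. -/
structure IsDirichletSolution (f : ℝ → ℝ → ℝ) (F a b : ℝ) (u : ℝ → ℝ) : Prop where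
  continuousOn : ContinuousOn u (Icc a b)
  contDiffOn : ContDiffOn ℝ 2 u (Ioo a b)
  equation : ∀ x ∈ Ioo a b, deriv (deriv u) x + f x (u x) + F = 0
  left : u a = 0
  right : u b = 0

/-! With slope `K = 1`, a solution that dips below the tent is incompatible with large `F`, unless
the obstacles along its graph are exceptionally strong.

The analytic half is deterministic. Write `u'' = R - P` with `P = F + g` and `R` the obstacle force
along the graph, and let `T = ∫ R`. Green's formula at the dip (`weighted_mass_le`) bounds `∫ ρ P`
by `T + 2`, where `ρ` is a tent weight vanishing at the endpoints. Hence `F` times the length is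
controlled by `T`, and so is the weighted total variation `∫ ρ (P + R)` of `u'`. Now sample `u` on a
grid with one point per column: integer heights `H` and integer bounds `Z` for the curvature near
each column. In one column (`column_charge`) the graph is either steep relative to `Z`, passing many
obstacles and spending little time on each, or its range is of order `Z + 1`, and the strongest
obstacle within reach dominates. So `T` is bounded by the charge of a discrete path, and a dip gives
`∑ ρ Z + (F - 13) N ≤ 8 M · charge` (`exists_charged_path`).

The probabilistic half is a union bound over all discrete paths. For a single path, Chernoff's
inequality gives probability at most `exp (18 N - γ (F - 13) N - γ ∑ ρ Z)`. A path is determined by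
its second differences, so for given `Z` there are only `O((Z + 1)²)` choices per column, and the
energy factor makes the sum over each column finite, of order `ρ⁻³`. Although `ρ` degenerates at the
boundary, the product of these factors is still only exponential in `N` (`prod_inv_weight_le`).
Large `F` beats this entropy. The bad event involves only the obstacle strengths, so its complement
serves all solutions `u` simultaneously. -/

/-! ### Green's formula and difference quotients -/

/-- A function which is `C²` inside `[a, b]`, continuous on `[a, b]`, and whose second derivative
is a continuous function `q`, agrees on `[a, b]` with a solution of `v'' = q` on the line. -/
theorem exists_global_primitive {u q : ℝ → ℝ} {a b : ℝ} (hab : a < b)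
    (hu : ContinuousOn u (Icc a b)) (hu2 : ContDiffOn ℝ 2 u (Ioo a b)) (hq : Continuous q)
    (h : ∀ x ∈ Ioo a b, deriv (deriv u) x = q x) :
    ∃ v v' : ℝ → ℝ, (∀ x, HasDerivAt v (v' x) x) ∧ (∀ x, HasDerivAt v' (q x) x) ∧
      ∀ x ∈ Icc a b, u x = v x := by
  set w' : ℝ → ℝ := fun x => ∫ t in a..x, q t with hw'
  have hw'd : ∀ x, HasDerivAt w' (q x) x := fun x => (hq.integral_hasStrictDerivAt a x).hasDerivAt
  have hw'c : Continuous w' := continuous_iff_continuousAt.2 fun x => (hw'd x).continuousAt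
  set w : ℝ → ℝ := fun x => ∫ t in a..x, w' t with hw
  have hwd : ∀ x, HasDerivAt w (w' x) x := fun x => (hw'c.integral_hasStrictDerivAt a x).hasDerivAt
  have h2 := (contDiffOn_succ_iff_deriv_of_isOpen (n := 1) isOpen_Ioo).1
    (by simpa [one_add_one_eq_two] using hu2)
  have hdu : DifferentiableOn ℝ u (Ioo a b) := h2.1
  have hddu : DifferentiableOn ℝ (deriv u) (Ioo a b) := h2.2.2.differentiableOn (by simp)
  obtain ⟨c, hc⟩ := isOpen_Ioo.exists_is_const_of_deriv_eq_zero (s := Ioo a b)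
    (f := fun x => deriv u x - w' x) isPreconnected_Ioo
    (hddu.sub fun x _ => (hw'd x).differentiableAt.differentiableWithinAt) (by
      intro x hx
      have h1 : HasDerivAt (deriv u) (deriv (deriv u) x) x :=
        (hddu.differentiableAt (isOpen_Ioo.mem_nhds hx)).hasDerivAt
      have := (h1.sub (hw'd x)).deriv
      simp only [Pi.zero_apply]
      rw [show (fun x => deriv u x - w' x) = deriv u - w' from rfl, this, h x hx, sub_self])
  have hvd : ∀ x, HasDerivAt (fun x => w x + c * x) (w' x + c) x := fun x =>
    ((hwd x).add ((hasDerivAt_id x).const_mul c)).congr_deriv (by simp)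
  obtain ⟨d, hd⟩ := isOpen_Ioo.exists_is_const_of_deriv_eq_zero (s := Ioo a b)
    (f := fun x => u x - (w x + c * x)) isPreconnected_Ioo
    (hdu.sub fun x _ => (hvd x).differentiableAt.differentiableWithinAt) (by
      intro x hx
      have h1 : HasDerivAt u (deriv u x) x :=
        (hdu.differentiableAt (isOpen_Ioo.mem_nhds hx)).hasDerivAt
      have := (h1.sub (hvd x)).deriv
      have h3 := hc x hx
      simp only [Pi.zero_apply]
      rw [show (fun x => u x - (w x + c * x)) = u - fun x => w x + c * x from rfl, this]
      linarith)
  refine ⟨fun x => w x + c * x + d, fun x => w' x + c, fun x => (hvd x).add_const d,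
    fun x => (hw'd x).add_const c, ?_⟩
  have hcont : Continuous fun x => w x + c * x + d :=
    continuous_iff_continuousAt.2 fun x => ((hvd x).add_const d).continuousAt
  refine EqOn.of_subset_closure (s := Ioo a b) (fun x hx => ?_) hu hcont.continuousOn
    Ioo_subset_Icc_self (by rw [closure_Ioo hab.ne])
  have h3 : u x - (w x + c * x) = d := hd x hx
  change u x = w x + c * x + d
  linarith

/-- The Green kernel of the interval `[p, r]` with pole `m`, up to the factor `r - p`. -/
def tent (p m r z : ℝ) : ℝ := min ((r - m) * (z - p)) ((m - p) * (r - z))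

theorem continuous_tent (p m r : ℝ) : Continuous (tent p m r) := by
  unfold tent; fun_prop

theorem tent_nonneg {p m r z : ℝ} (hpm : p ≤ m) (hmr : m ≤ r) (hz : z ∈ Icc p r) :
    0 ≤ tent p m r z :=
  le_min (mul_nonneg (by linarith) (by linarith [hz.1])) (mul_nonneg (by linarith) (by linarith [hz.2]))

/-- Integrate by parts on each side of `m`; the two boundary terms containing `v' m` cancel. -/
theorem three_point {v v' q : ℝ → ℝ} (hv : ∀ x, HasDerivAt v (v' x) x)
    (hv' : ∀ x, HasDerivAt v' (q x) x) (hq : Continuous q) {p m r : ℝ} (hpm : p ≤ m)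
    (hmr : m ≤ r) :
    (r - m) * v p + (m - p) * v r - (r - p) * v m = ∫ z in p..r, tent p m r z * q z := by
  have h1 : ∫ z in p..m, tent p m r z * q z = (r - m) * ((m - p) * v' m - v m + v p) := by
    have : ∫ z in p..m, tent p m r z * q z = ∫ z in p..m, (r - m) * ((z - p) * q z) := by
      refine intervalIntegral.integral_congr fun z hz => ?_
      rw [uIcc_of_le hpm] at hz
      have : tent p m r z = (r - m) * (z - p) := by
        refine min_eq_left ?_
        nlinarith [mul_nonneg (sub_nonneg.2 hz.2) (sub_nonneg.2 (hpm.trans hmr))]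
      simp only [this]; ring
    rw [this, intervalIntegral.integral_const_mul]
    have hd : ∀ x, HasDerivAt (fun x => (x - p) * v' x - v x) ((x - p) * q x) x := fun x => by
      have := (((hasDerivAt_id x).sub_const p).mul (hv' x)).sub (hv x)
      refine this.congr_deriv ?_
      simp
    rw [intervalIntegral.integral_eq_sub_of_hasDerivAt (fun x _ => hd x)
      (by apply Continuous.intervalIntegrable; fun_prop)]
    ring
  have h2 : ∫ z in m..r, tent p m r z * q z = (m - p) * (v r - v m - (r - m) * v' m) := by
    have : ∫ z in m..r, tent p m r z * q z = ∫ z in m..r, (m - p) * ((r - z) * q z) := by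
      refine intervalIntegral.integral_congr fun z hz => ?_
      rw [uIcc_of_le hmr] at hz
      have : tent p m r z = (m - p) * (r - z) := by
        refine min_eq_right ?_
        nlinarith [mul_nonneg (sub_nonneg.2 hz.1) (sub_nonneg.2 (hpm.trans hmr))]
      simp only [this]; ring
    rw [this, intervalIntegral.integral_const_mul]
    have hd : ∀ x, HasDerivAt (fun x => (r - x) * v' x + v x) ((r - x) * q x) x := fun x => by
      have := (((hasDerivAt_id x).const_sub r).mul (hv' x)).add (hv x)
      refine this.congr_deriv ?_
      simp
    rw [intervalIntegral.integral_eq_sub_of_hasDerivAt (fun x _ => hd x)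
      (by apply Continuous.intervalIntegrable; fun_prop)]
    ring
  have hint : ∀ s t, IntervalIntegrable (fun z => tent p m r z * q z) volume s t := fun s t =>
    ((continuous_tent p m r).mul hq).intervalIntegrable s t
  rw [← intervalIntegral.integral_add_adjacent_intervals (hint p m) (hint m r), h1, h2]
  ring

theorem abs_integral_mul_le {k k' q Q : ℝ → ℝ} {p r : ℝ} (hpr : p ≤ r) (hk : Continuous k)
    (hk' : Continuous k') (hq : Continuous q) (hQ : Continuous Q) (h0 : ∀ z ∈ Icc p r, 0 ≤ k z)
    (h1 : ∀ z ∈ Icc p r, k z ≤ k' z) (h2 : ∀ z, |q z| ≤ Q z) :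
    |∫ z in p..r, k z * q z| ≤ ∫ z in p..r, k' z * Q z := by
  refine (intervalIntegral.abs_integral_le_integral_abs hpr).trans ?_
  refine intervalIntegral.integral_mono_on hpr ?_ ?_ fun z hz => ?_
  · exact (hk.mul hq).abs.intervalIntegrable _ _
  · exact (hk'.mul hQ).intervalIntegrable _ _
  · rw [abs_mul, abs_of_nonneg (h0 z hz)]
    exact mul_le_mul (h1 z hz) (h2 z) (abs_nonneg _) ((h0 z hz).trans (h1 z hz))

/-- The curvature of `Q` seen by the hat function over `[p, r]`. -/
noncomputable def hatMass (Q : ℝ → ℝ) (p r : ℝ) : ℝ := ∫ z in p..r, min (z - p) (r - z) * Q z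

theorem hatMass_nonneg {Q : ℝ → ℝ} (hQ : ∀ z, 0 ≤ Q z) {p r : ℝ} (hpr : p ≤ r) :
    0 ≤ hatMass Q p r :=
  intervalIntegral.integral_nonneg hpr fun z hz =>
    mul_nonneg (le_min (by linarith [hz.1]) (by linarith [hz.2])) (hQ z)

theorem abs_second_difference_le {v v' q Q : ℝ → ℝ} (hv : ∀ x, HasDerivAt v (v' x) x)
    (hv' : ∀ x, HasDerivAt v' (q x) x) (hq : Continuous q) (hQ : Continuous Q)
    (hqQ : ∀ z, |q z| ≤ Q z) {m η : ℝ} (hη : 0 < η) :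
    |v (m + η) - 2 * v m + v (m - η)| ≤ hatMass Q (m - η) (m + η) := by
  have h := three_point hv hv' hq (p := m - η) (m := m) (r := m + η) (by linarith) (by linarith)
  have h1 : ∀ z, tent (m - η) m (m + η) z = η * min (z - (m - η)) (m + η - z) := fun z => by
    unfold tent
    rw [mul_min_of_nonneg _ _ hη.le]
    congr 1 <;> ring
  have h2 : η * (v (m + η) - 2 * v m + v (m - η)) =
      η * ∫ z in (m - η)..(m + η), min (z - (m - η)) (m + η - z) * q z := by
    rw [← intervalIntegral.integral_const_mul]
    simp only [h1, mul_assoc] at h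
    rw [← h]; ring
  rw [mul_left_cancel₀ hη.ne' h2]
  refine abs_integral_mul_le (by linarith) (by fun_prop) (by fun_prop) hq hQ ?_ (fun _ _ => le_rfl)
    hqQ
  exact fun z hz => le_min (by linarith [hz.1]) (by linarith [hz.2])

/-- Subtract the three-point identities for `(p, y, y')` and `(y, y', r)`. Both kernels are at most
`(y' - y) * (2 / c)` times the hat over `[p, r]`, since their supports stay at distance `c` from one
endpoint. Keeping the factor `y' - y` makes this a comparison of slopes: a steep secant forces
steepness at every scale inside. -/
theorem abs_secant_sub_le {v v' q Q : ℝ → ℝ} (hv : ∀ x, HasDerivAt v (v' x) x)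
    (hv' : ∀ x, HasDerivAt v' (q x) x) (hq : Continuous q) (hQ : Continuous Q)
    (hqQ : ∀ z, |q z| ≤ Q z) {p r c y y' : ℝ} (hc : 0 < c) (hpr : r - p ≤ 2) (hy : p + c ≤ y)
    (hyy : y ≤ y') (hy' : y' ≤ r - c) :
    |(y' - y) * (v r - v p) - (r - p) * (v y' - v y)| ≤ 4 / c * hatMass Q p r * (y' - y) := by
  have hQ0 : ∀ z, 0 ≤ Q z := fun z => (abs_nonneg _).trans (hqQ z)
  have hc1 : 1 ≤ 2 / c := by rw [le_div_iff₀ hc]; linarith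
  have hint : ∀ s t, IntervalIntegrable (fun z => min (z - p) (r - z) * Q z) volume s t :=
    fun s t => by apply Continuous.intervalIntegrable; fun_prop
  have e1 := three_point hv hv' hq (p := p) (m := y) (r := y') (by linarith) hyy
  have e2 := three_point hv hv' hq (p := y) (m := y') (r := r) hyy (by linarith)
  have b1 : |∫ z in p..y', tent p y y' z * q z| ≤ (y' - y) * (2 / c) * hatMass Q p r := by
    refine (abs_integral_mul_le (k' := fun z => (y' - y) * (2 / c) * min (z - p) (r - z))
      (by linarith) (continuous_tent _ _ _) (by fun_prop) hq hQ
      (fun z hz => tent_nonneg (by linarith) hyy hz) ?_ hqQ).trans ?_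
    · intro z hz
      refine (min_le_left _ _).trans ?_
      rw [mul_assoc]
      refine mul_le_mul_of_nonneg_left ?_ (by linarith)
      rw [mul_min_of_nonneg _ _ (by positivity)]
      refine le_min (by nlinarith [hz.1]) ?_
      have : 2 ≤ 2 / c * (r - z) := by
        rw [div_mul_eq_mul_div, le_div_iff₀ hc]; nlinarith [hz.2]
      linarith [hz.2]
    · simp only [mul_assoc]
      rw [intervalIntegral.integral_const_mul, intervalIntegral.integral_const_mul]
      refine mul_le_mul_of_nonneg_left (mul_le_mul_of_nonneg_left ?_ (by positivity)) (by linarith)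
      refine intervalIntegral.integral_mono_interval le_rfl (by linarith) (by linarith) ?_ (hint _ _)
      filter_upwards [ae_restrict_mem measurableSet_Ioc] with z hz
      exact mul_nonneg (le_min (by linarith [hz.1]) (by linarith [hz.2])) (hQ0 z)
  have b2 : |∫ z in y..r, tent y y' r z * q z| ≤ (y' - y) * (2 / c) * hatMass Q p r := by
    refine (abs_integral_mul_le (k' := fun z => (y' - y) * (2 / c) * min (z - p) (r - z))
      (by linarith) (continuous_tent _ _ _) (by fun_prop) hq hQ
      (fun z hz => tent_nonneg hyy (by linarith) hz) ?_ hqQ).trans ?_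
    · intro z hz
      refine (min_le_right _ _).trans ?_
      rw [mul_assoc]
      refine mul_le_mul_of_nonneg_left ?_ (by linarith)
      rw [mul_min_of_nonneg _ _ (by positivity)]
      refine le_min ?_ (by nlinarith [hz.2])
      have : 2 ≤ 2 / c * (z - p) := by
        rw [div_mul_eq_mul_div, le_div_iff₀ hc]; nlinarith [hz.1]
      linarith [hz.1]
    · simp only [mul_assoc]
      rw [intervalIntegral.integral_const_mul, intervalIntegral.integral_const_mul]
      refine mul_le_mul_of_nonneg_left (mul_le_mul_of_nonneg_left ?_ (by positivity)) (by linarith)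
      refine intervalIntegral.integral_mono_interval (by linarith) (by linarith) le_rfl ?_ (hint _ _)
      filter_upwards [ae_restrict_mem measurableSet_Ioc] with z hz
      exact mul_nonneg (le_min (by linarith [hz.1]) (by linarith [hz.2])) (hQ0 z)
  rw [← e1] at b1
  rw [← e2] at b2
  have : (y' - y) * (v r - v p) - (r - p) * (v y' - v y) =
      ((r - y') * v y + (y' - y) * v r - (r - y) * v y') -
        ((y' - y) * v p + (y - p) * v y' - (y' - p) * v y) := by ring
  rw [this]
  refine (abs_sub _ _).trans ((add_le_add b2 b1).trans (le_of_eq ?_))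
  ring

/-! ### A dip forces obstacle mass -/

/-- If a solution of `v'' = R - P` with zero boundary values dips below `a - |x₀|` at a point
`x₀`, the weighted mass of `P` is controlled by the mass of `R`. -/
theorem weighted_mass_le {v v' P R : ℝ → ℝ} (hP : Continuous P) (hR : Continuous R)
    (hP0 : ∀ z, 0 ≤ P z) (hR0 : ∀ z, 0 ≤ R z) (hv : ∀ x, HasDerivAt v (v' x) x)
    (hv' : ∀ x, HasDerivAt v' (R x - P x) x) {a x₀ : ℝ} (hx₀ : |x₀| < a)
    (hl : v (-a) = 0) (hr : v a = 0) (hviol : v x₀ < a - |x₀|) :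
    ∫ z in (-a)..a, (a - |z|) / (2 * a) * P z ≤ (∫ z in (-a)..a, R z) + 2 := by
  have ha : 0 < a := (abs_nonneg _).trans_lt hx₀
  obtain ⟨h1, h2⟩ := abs_lt.1 hx₀
  have e := three_point hv hv' (hR.sub hP) (p := -a) (m := x₀) (r := a) h1.le h2.le
  set B := (a + x₀) * (a - x₀) with hB
  have hB0 : 0 < B := mul_pos (by linarith) (by linarith)
  -- `B` is the maximum of the Green kernel. It is at least `a` times the height of the tent at
  -- `x₀`, so the term `2 * a * v x₀` costs at most `2 * B`, however close `x₀` is to the boundary.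
  have hB1 : a * (a - |x₀|) ≤ B := by
    have : B = (a + |x₀|) * (a - |x₀|) := by
      rw [hB]; nlinarith [abs_mul_abs_self x₀]
    rw [this]
    nlinarith [abs_nonneg x₀]
  have ct := continuous_tent (-a) x₀ a
  have e3 : ∫ z in (-a)..a, tent (-a) x₀ a z * (R z - P z) =
      (∫ z in (-a)..a, tent (-a) x₀ a z * R z) - ∫ z in (-a)..a, tent (-a) x₀ a z * P z := by
    rw [← intervalIntegral.integral_sub]
    · simp only [mul_sub]
    · exact (ct.mul hR).intervalIntegrable _ _
    · exact (ct.mul hP).intervalIntegrable _ _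
  have e4 : ∫ z in (-a)..a, tent (-a) x₀ a z * R z ≤ B * ∫ z in (-a)..a, R z := by
    rw [← intervalIntegral.integral_const_mul]
    refine intervalIntegral.integral_mono_on (by linarith) ((ct.mul hR).intervalIntegrable _ _)
      ((continuous_const.mul hR).intervalIntegrable _ _) fun z hz => ?_
    refine mul_le_mul_of_nonneg_right ?_ (hR0 z)
    rcases le_total z x₀ with h | h
    · exact (min_le_left _ _).trans (by rw [hB]; nlinarith [hz.1])
    · exact (min_le_right _ _).trans (by rw [hB]; nlinarith [hz.2])
  have e5 : B * ∫ z in (-a)..a, (a - |z|) / (2 * a) * P z ≤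
      ∫ z in (-a)..a, tent (-a) x₀ a z * P z := by
    rw [← intervalIntegral.integral_const_mul]
    refine intervalIntegral.integral_mono_on (by linarith) ?_ ((ct.mul hP).intervalIntegrable _ _)
      fun z hz => ?_
    · apply Continuous.intervalIntegrable; fun_prop
    · rw [← mul_assoc]
      refine mul_le_mul_of_nonneg_right ?_ (hP0 z)
      rw [← mul_div_assoc, div_le_iff₀ (by positivity)]
      unfold tent
      rw [min_mul_of_nonneg _ _ (by positivity)]
      have hz1 : a - |z| ≤ z + a := by linarith [neg_abs_le z]
      have hz2 : a - |z| ≤ a - z := by linarith [le_abs_self z]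
      have hz3 : 0 ≤ z + a := by linarith [hz.1]
      have hz4 : 0 ≤ a - z := by linarith [hz.2]
      refine le_min ?_ ?_
      · calc B * (a - |z|) ≤ B * (z + a) := by gcongr
          _ = (a - x₀) * (z - -a) * (a + x₀) := by rw [hB]; ring
          _ ≤ (a - x₀) * (z - -a) * (2 * a) :=
            mul_le_mul_of_nonneg_left (by linarith) (mul_nonneg (by linarith) (by linarith))
      · calc B * (a - |z|) ≤ B * (a - z) := by gcongr
          _ = (x₀ - -a) * (a - z) * (a - x₀) := by rw [hB]; ring
          _ ≤ (x₀ - -a) * (a - z) * (2 * a) :=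
            mul_le_mul_of_nonneg_left (by linarith) (mul_nonneg (by linarith) (by linarith))
  rw [hl, hr, e3] at e
  have : B * ∫ z in (-a)..a, (a - |z|) / (2 * a) * P z ≤ B * ((∫ z in (-a)..a, R z) + 2) := by
    nlinarith
  exact le_of_mul_le_mul_left this hB0

/-! ### Summing curvature over the grid -/

theorem sum_Ioo_int_succ (f : ℤ → ℝ) (n : ℕ) (hn : 1 ≤ n) :
    ∑ i ∈ Finset.Ioo (-((n + 1 : ℕ) : ℤ)) ((n + 1 : ℕ) : ℤ), f i =
      (∑ i ∈ Finset.Ioo (-(n : ℤ)) (n : ℤ), f i) + f n + f (-n) := by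
  have : Finset.Ioo (-((n + 1 : ℕ) : ℤ)) ((n + 1 : ℕ) : ℤ) =
      insert (n : ℤ) (insert (-(n : ℤ)) (Finset.Ioo (-(n : ℤ)) (n : ℤ))) := by
    ext i; simp only [Finset.mem_Ioo, Finset.mem_insert]; omega
  rw [this, Finset.sum_insert, Finset.sum_insert]
  · ring
  · simp
  · simp only [Finset.mem_insert, Finset.mem_Ioo]; omega

theorem sum_central_difference (g : ℤ → ℝ) (n : ℕ) (hn : 1 ≤ n) :
    ∑ i ∈ Finset.Ioo (-(n : ℤ)) (n : ℤ), (g (i + 1) - g (i - 1)) =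
      g n + g (n - 1) - g (-n) - g (1 - n) := by
  induction n, hn using Nat.le_induction with
  | base =>
    have : Finset.Ioo (-((1 : ℕ) : ℤ)) ((1 : ℕ) : ℤ) = {0} := by decide
    rw [this]; simp; ring
  | succ n hn ih =>
    rw [sum_Ioo_int_succ _ n hn, ih]
    push_cast
    rw [show (n : ℤ) + 1 - 1 = n by ring, show -((n : ℤ) + 1) = -n - 1 by ring,
      show 1 - ((n : ℤ) + 1) = -n by ring, show (1 : ℤ) - n = -n + 1 by ring]
    ring

/-- On each interval the discrete weight times the hat is at most the continuous weight, using `n -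
|i| ≥ 1` and `η ≤ 1`. Consecutive intervals overlap, so each point is counted at most twice; the sum
of central differences makes this precise. -/
theorem sum_hatMass_le {Q : ℝ → ℝ} (hQ : Continuous Q) (hQ0 : ∀ z, 0 ≤ Q z) {η : ℝ} (hη : 0 < η)
    (hη1 : η ≤ 1) {n : ℕ} (hn : 1 ≤ n) :
    ∑ i ∈ Finset.Ioo (-(n : ℤ)) (n : ℤ), ((n : ℝ) - |(i : ℝ)|) / (2 * n) *
        hatMass Q (i * η - η) (i * η + η) ≤
      2 * ∫ z in (-(n * η))..(n * η), (n * η - |z|) / (2 * (n * η)) * Q z := by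
  have hn0 : (0 : ℝ) < n := by exact_mod_cast hn
  set w : ℝ → ℝ := fun z => (n * η - |z|) / (2 * (n * η)) * Q z with hw
  have hwc : Continuous w := by
    rw [hw]; fun_prop
  have hint : ∀ s t, IntervalIntegrable w volume s t := fun s t => hwc.intervalIntegrable s t
  have hw0 : ∀ z, |z| ≤ n * η → 0 ≤ w z := fun z hz =>
    mul_nonneg (div_nonneg (by linarith) (by positivity)) (hQ0 z)
  set G : ℤ → ℝ := fun i => ∫ z in (-(n * η))..(i * η), w z with hG
  have hterm : ∀ i ∈ Finset.Ioo (-(n : ℤ)) (n : ℤ), ((n : ℝ) - |(i : ℝ)|) / (2 * n) *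
      hatMass Q (i * η - η) (i * η + η) ≤ G (i + 1) - G (i - 1) := by
    intro i hi
    rw [Finset.mem_Ioo] at hi
    have hi1 : (1 : ℝ) - n ≤ i := by
      have : (1 : ℤ) - n ≤ i := by omega
      exact_mod_cast this
    have hi2 : (i : ℝ) ≤ n - 1 := by
      have : i ≤ (n : ℤ) - 1 := by omega
      exact_mod_cast this
    have hia : |(i : ℝ)| ≤ n - 1 := abs_le.2 ⟨by linarith, hi2⟩
    have e : G (i + 1) - G (i - 1) = ∫ z in (i * η - η)..(i * η + η), w z := by
      rw [hG]
      simp only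
      rw [intervalIntegral.integral_interval_sub_left (hint _ _) (hint _ _)]
      push_cast
      congr 1 <;> ring
    rw [e, hatMass, ← intervalIntegral.integral_const_mul]
    refine intervalIntegral.integral_mono_on (by linarith) ?_ (hint _ _) fun z hz => ?_
    · apply Continuous.intervalIntegrable; fun_prop
    · rw [hw, ← mul_assoc]
      refine mul_le_mul_of_nonneg_right ?_ (hQ0 z)
      rw [div_mul_eq_mul_div, div_le_div_iff₀ (by positivity) (by positivity)]
      set m := min (z - (i * η - η)) (i * η + η - z) with hm
      have hm0 : 0 ≤ m := le_min (by linarith [hz.1]) (by linarith [hz.2])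
      have hm1 : m ≤ η - |z - i * η| := by
        rcases abs_cases (z - i * η) with h | h
        · exact (min_le_right _ _).trans (by linarith)
        · exact (min_le_left _ _).trans (by linarith)
      have hz1 : |z| ≤ |z - i * η| + |(i : ℝ)| * η := by
        calc |z| = |(z - i * η) + i * η| := by ring_nf
          _ ≤ |z - i * η| + |i * η| := abs_add_le _ _
          _ = _ := by rw [abs_mul, abs_of_pos hη]
      have key : (n - |(i : ℝ)|) * m ≤ n * η - |z| := by
        have h1 : (n - |(i : ℝ)|) * m ≤ (n - |(i : ℝ)|) * (η - |z - i * η|) :=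
          mul_le_mul_of_nonneg_left hm1 (by linarith)
        nlinarith [abs_nonneg (z - i * η)]
      have : (n - |(i : ℝ)|) * m * (2 * (n * η)) ≤ (n - |(i : ℝ)|) * m * (2 * n) :=
        mul_le_mul_of_nonneg_left (by nlinarith) (mul_nonneg (by linarith) hm0)
      nlinarith
  refine (Finset.sum_le_sum hterm).trans ?_
  rw [sum_central_difference G n hn]
  have g1 : G (-(n : ℤ)) = 0 := by simp [hG]
  have g2 : G n = ∫ z in (-(n * η))..(n * η), w z := by simp [hG]
  have g3 : 0 ≤ G (1 - n) := by
    simp only [hG]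
    have h1n : (1 : ℝ) ≤ n := by exact_mod_cast hn
    push_cast
    refine intervalIntegral.integral_nonneg (by nlinarith) fun z hz => hw0 z ?_
    rw [abs_le]; exact ⟨by linarith [hz.1], hz.2.trans (by nlinarith)⟩
  have g4 : G (n - 1) ≤ G n := by
    have h1n : (1 : ℝ) ≤ n := by exact_mod_cast hn
    have : G n - G (n - 1) = ∫ z in ((n - 1) * η)..(n * η), w z := by
      simp only [hG]
      rw [intervalIntegral.integral_interval_sub_left (hint _ _) (hint _ _)]
      push_cast; rfl
    have h0 : 0 ≤ ∫ z in ((n - 1) * η)..(n * η), w z := by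
      refine intervalIntegral.integral_nonneg (by nlinarith) fun z hz => hw0 z ?_
      rw [abs_le]; exact ⟨by nlinarith [hz.1], hz.2⟩
    linarith
  rw [g1, ← g2]; linarith

/-! ### Time spent at the obstacles of one column -/

/-- The part of the column of half-width `δ` around `t` in which `v` is `δ`-close to the height
`j + 1/2`. -/
def visitSet (δ t : ℝ) (v : ℝ → ℝ) (j : ℤ) : Set ℝ :=
  {y | y ∈ Icc (t - δ) (t + δ) ∧ |v y - (j + 1 / 2)| ≤ δ}

theorem isClosed_visitSet {δ t : ℝ} {v : ℝ → ℝ} (hv : Continuous v) (j : ℤ) :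
    IsClosed (visitSet δ t v j) :=
  isClosed_Icc.inter (isClosed_le (hv.sub continuous_const).abs continuous_const)

theorem visitSet_subset {δ t : ℝ} {v : ℝ → ℝ} {j : ℤ} :
    visitSet δ t v j ⊆ Icc (t - δ) (t + δ) := fun _ h => h.1

theorem volume_visitSet_ne_top {δ t : ℝ} {v : ℝ → ℝ} {j : ℤ} :
    volume (visitSet δ t v j) ≠ ⊤ :=
  ((measure_mono visitSet_subset).trans_lt measure_Icc_lt_top).ne

theorem disjoint_visitSet {δ t : ℝ} {v : ℝ → ℝ} (hδ : δ < 1 / 2) {i j : ℤ} (hij : i ≠ j) :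
    Disjoint (visitSet δ t v i) (visitSet δ t v j) := by
  rw [Set.disjoint_left]
  rintro y ⟨-, h1⟩ ⟨-, h2⟩
  rw [abs_le] at h1 h2
  refine hij (le_antisymm ?_ ?_)
  · have : (i : ℝ) < j + 1 := by linarith
    exact Int.lt_add_one_iff.1 (by exact_mod_cast this)
  · have : (j : ℝ) < i + 1 := by linarith
    exact Int.lt_add_one_iff.1 (by exact_mod_cast this)

theorem sum_volume_visitSet_le {δ t : ℝ} {v : ℝ → ℝ} (hv : Continuous v) (hδ0 : 0 < δ)
    (hδ : δ < 1 / 2) (S : Finset ℤ) : ∑ j ∈ S, volume.real (visitSet δ t v j) ≤ 1 := by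
  rw [← measureReal_biUnion_finset (fun i _ j _ hij => disjoint_visitSet hδ hij)
    (fun j _ => (isClosed_visitSet hv j).measurableSet) (fun j _ => volume_visitSet_ne_top)]
  refine (measureReal_mono (s₂ := Icc (t - δ) (t + δ)) (iUnion₂_subset fun j _ => visitSet_subset)
    measure_Icc_lt_top.ne).trans ?_
  rw [Real.volume_real_Icc_of_le (by linarith)]
  linarith

/-- Two visiting points have heights within `2 * δ < 1` of each other, so the visit set has diameter
at most `1 / σ`. -/
theorem volume_visitSet_le_of_steep {δ t σ : ℝ} {v : ℝ → ℝ} (hσ : 0 < σ)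
    (hδ : δ < 1 / 2)
    (h : ∀ y ∈ Icc (t - δ) (t + δ), ∀ y' ∈ Icc (t - δ) (t + δ), y ≤ y' →
      σ * (y' - y) ≤ |v y' - v y|) (j : ℤ) :
    volume.real (visitSet δ t v j) ≤ 1 / σ := by
  refine ENNReal.toReal_le_of_le_ofReal (by positivity) ((Real.volume_le_diam _).trans ?_)
  have key : ∀ y ∈ visitSet δ t v j, ∀ y' ∈ visitSet δ t v j, y ≤ y' → y' - y ≤ 1 / σ := by
    intro y hy y' hy' hyy
    rw [le_div_iff₀ hσ, mul_comm]
    refine (h y hy.1 y' hy'.1 hyy).trans ?_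
    have h1 := abs_le.1 hy.2
    have h2 := abs_le.1 hy'.2
    rw [abs_le]; constructor <;> linarith
  refine Metric.ediam_le fun y hy y' hy' => ?_
  rw [edist_dist, Real.dist_eq]
  refine ENNReal.ofReal_le_ofReal ?_
  rcases le_total y y' with hyy | hyy
  · rw [abs_sub_comm, abs_of_nonneg (by linarith)]; exact key y hy y' hy' hyy
  · rw [abs_of_nonneg (by linarith)]; exact key y' hy' y hy hyy

/-- The obstacles of a column charged to a path with height `h`, slope `σ` and curvature `Z`
there: all those near `h` if the path is steep, a single one otherwise. -/
noncomputable def chargedNodes (A Z σ : ℕ) (h m : ℤ) : Finset ℤ :=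
  if A * (Z + 1) ≤ σ then Finset.Icc (h - (2 * σ + 2)) (h + (2 * σ + 2)) else {h + m}

/-- The weight with which each obstacle of `chargedNodes` is charged. -/
noncomputable def chargeWeight (A Z σ : ℕ) : ℝ := if A * (Z + 1) ≤ σ then 4 / σ else 1

theorem chargeWeight_nonneg (A Z σ : ℕ) : 0 ≤ chargeWeight A Z σ := by
  unfold chargeWeight; split_ifs <;> positivity

theorem chargeWeight_le {A Z σ : ℕ} (hA : 1 ≤ A) : chargeWeight A Z σ ≤ 4 := by
  unfold chargeWeight
  split_ifs with h
  · have : 1 ≤ σ := le_trans (by nlinarith) h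
    have : (1 : ℝ) ≤ σ := by exact_mod_cast this
    exact div_le_self (by norm_num) this
  · norm_num

theorem sum_chargeWeight_le {A Z σ : ℕ} (hA : 1 ≤ A) (h m : ℤ) :
    ∑ _j ∈ chargedNodes A Z σ h m, chargeWeight A Z σ ≤ 36 := by
  unfold chargeWeight chargedNodes
  split_ifs with hs
  · have : 1 ≤ σ := le_trans (by nlinarith) hs
    have h1 : (1 : ℝ) ≤ σ := by exact_mod_cast this
    rw [Finset.sum_const, Int.card_Icc, nsmul_eq_mul]
    have : (h + (2 * (σ : ℤ) + 2) + 1 - (h - (2 * σ + 2))).toNat = 4 * σ + 5 := by omega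
    rw [this, ← mul_div_assoc, div_le_iff₀ (by linarith)]
    push_cast; linarith
  · simp

/-- The secant over the grid cell fixes every slope in the column up to an error `1 + C * Z`. If `σ`
dominates this error, every slope is at least `σ / 4`: each visit lasts at most `4 / σ`, and only
nodes within `2 * σ + 2` of the sampled height are met. Otherwise the range of heights is `O(Z +
1)`, and as the total visiting time is at most one, the strongest obstacle in that range pays for
all. -/
theorem column_charge {δ t x σ' C A' : ℝ} {v : ℝ → ℝ} (hv : Continuous v) (hδ0 : 0 < δ)
    (hδ : δ < 1 / 2) (hx : x ∈ Icc (t - δ) (t + δ)) {η S : ℝ} (hη : 1 / 2 ≤ η) (hη1 : η ≤ 1)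
    (hsec : ∀ y ∈ Icc (t - δ) (t + δ), ∀ y' ∈ Icc (t - δ) (t + δ), y ≤ y' →
      |(y' - y) * S - 2 * η * (v y' - v y)| ≤ C * A' * (y' - y))
    (hC : 0 ≤ C) {Z σ A : ℕ} (hA' : A' ≤ Z) (hσ' : σ' = σ) (hσ : |(|S| - σ')| ≤ 1)
    (hA : 2 * (1 + C) ≤ A) {l : ℤ → ℝ} (hl : ∀ j, 0 ≤ l j) (s : Finset ℤ) :
    ∃ m : ℤ, |m| ≤ (2 * A + 2) * (Z + 1) ∧
      ∑ j ∈ s, l j * volume.real (visitSet δ t v j) ≤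
        ∑ j ∈ chargedNodes A Z σ ⌊v x⌋ m, chargeWeight A Z σ * l j := by
  subst hσ'
  have hσ1 := abs_le.1 hσ
  have hCA : C * A' ≤ C * Z := mul_le_mul_of_nonneg_left hA' hC
  have hZ0 : (0 : ℝ) ≤ Z := Nat.cast_nonneg Z
  have hup : ∀ y ∈ Icc (t - δ) (t + δ), ∀ y' ∈ Icc (t - δ) (t + δ), y ≤ y' →
      |v y' - v y| ≤ (σ + 1 + C * Z) * (y' - y) := by
    intro y hy y' hy' hyy
    have h1 := hsec y hy y' hy' hyy
    have h2 : 2 * η * |v y' - v y| ≤ (σ + 1 + C * Z) * (y' - y) := by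
      calc 2 * η * |v y' - v y| = |2 * η * (v y' - v y)| := by
            rw [abs_mul, abs_of_nonneg (by linarith : 0 ≤ 2 * η)]
        _ = |(y' - y) * S - ((y' - y) * S - 2 * η * (v y' - v y))| := by ring_nf
        _ ≤ |(y' - y) * S| + |(y' - y) * S - 2 * η * (v y' - v y)| := abs_sub _ _
        _ ≤ (y' - y) * |S| + C * A' * (y' - y) := by
            rw [abs_mul, abs_of_nonneg (by linarith : 0 ≤ y' - y)]; linarith
        _ ≤ (σ + 1 + C * Z) * (y' - y) := by
            nlinarith [mul_nonneg (sub_nonneg.2 hyy) (sub_nonneg.2 hCA)]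
    nlinarith [abs_nonneg (v y' - v y)]
  have hlow : ∀ y ∈ Icc (t - δ) (t + δ), ∀ y' ∈ Icc (t - δ) (t + δ), y ≤ y' →
      (σ - 1 - C * Z) * (y' - y) ≤ 2 * |v y' - v y| := by
    intro y hy y' hy' hyy
    have h1 := hsec y hy y' hy' hyy
    have h2 : (σ - 1 - C * Z) * (y' - y) ≤ 2 * η * |v y' - v y| := by
      calc (σ - 1 - C * Z) * (y' - y) ≤ (y' - y) * |S| - C * A' * (y' - y) := by
            nlinarith [mul_nonneg (sub_nonneg.2 hyy) (sub_nonneg.2 hCA)]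
        _ ≤ |(y' - y) * S| - |(y' - y) * S - 2 * η * (v y' - v y)| := by
            rw [abs_mul (y' - y), abs_of_nonneg (by linarith : 0 ≤ y' - y)]; linarith
        _ ≤ |(y' - y) * S - ((y' - y) * S - 2 * η * (v y' - v y))| := abs_sub_abs_le_abs_sub _ _
        _ = |2 * η * (v y' - v y)| := by ring_nf
        _ = 2 * η * |v y' - v y| := by
            rw [abs_mul, abs_of_nonneg (by linarith : 0 ≤ 2 * η)]
    nlinarith [abs_nonneg (v y' - v y)]
  have hfl := Int.floor_le (v x)
  have hlf := Int.lt_floor_add_one (v x)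
  have hrange : ∀ y ∈ Icc (t - δ) (t + δ), |v y - v x| ≤ σ + 1 + C * Z := by
    intro y hy
    have h0 : 0 ≤ σ + 1 + C * Z := by positivity
    rcases le_total x y with h | h
    · refine (hup x hx y hy h).trans (mul_le_of_le_one_right h0 ?_)
      linarith [hx.1, hy.2]
    · rw [abs_sub_comm]
      refine (hup y hy x hx h).trans (mul_le_of_le_one_right h0 ?_)
      linarith [hx.2, hy.1]
  -- The final `2` covers the floor of `v x` and the offset `1 / 2 + δ < 1` between a node's index
  -- and the visiting height.
  have hnode : ∀ j : ℤ, volume.real (visitSet δ t v j) ≠ 0 →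
      |(j : ℝ) - ⌊v x⌋| ≤ σ + 1 + C * Z + 2 := by
    intro j hj
    obtain ⟨y, hy⟩ : (visitSet δ t v j).Nonempty := by
      rw [Set.nonempty_iff_ne_empty]; rintro h; simp [h] at hj
    have h1 := abs_le.1 (hrange y hy.1)
    have h2 := abs_le.1 hy.2
    rw [abs_le]; constructor <;> linarith
  by_cases hs : A * (Z + 1) ≤ σ
  · have hs' : (A : ℝ) * (Z + 1) ≤ σ := by exact_mod_cast hs
    have hs2 : 1 + C * Z ≤ σ / 2 := by nlinarith
    have hσpos : (0 : ℝ) < σ := by nlinarith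
    refine ⟨0, by simp; positivity, ?_⟩
    simp only [chargedNodes, chargeWeight, hs, if_true]
    have hvis : ∀ j, volume.real (visitSet δ t v j) ≤ 4 / σ := by
      intro j
      refine (volume_visitSet_le_of_steep (σ := σ / 4) (by positivity) hδ
        (fun y hy y' hy' hyy => ?_) j).trans (by rw [one_div_div])
      have := hlow y hy y' hy' hyy
      nlinarith [mul_nonneg (sub_nonneg.2 hyy) (sub_nonneg.2 hs2)]
    calc ∑ j ∈ s, l j * volume.real (visitSet δ t v j)
        = ∑ j ∈ s with volume.real (visitSet δ t v j) ≠ 0,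
            l j * volume.real (visitSet δ t v j) := by
          rw [Finset.sum_filter_of_ne]; intro j _ h hh; exact h (by rw [hh, mul_zero])
      _ ≤ ∑ j ∈ s with volume.real (visitSet δ t v j) ≠ 0, 4 / σ * l j := by
          refine Finset.sum_le_sum fun j _ => ?_
          rw [mul_comm]; exact mul_le_mul_of_nonneg_right (hvis j) (hl j)
      _ ≤ _ := by
          refine Finset.sum_le_sum_of_subset_of_nonneg (fun j hj => ?_)
            fun j _ _ => mul_nonneg (by positivity) (hl j)
          have h1 := abs_le.1 (hnode j (Finset.mem_filter.1 hj).2)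
          rw [Finset.mem_Icc]
          constructor
          · have : ((⌊v x⌋ - (2 * σ + 2) : ℤ) : ℝ) ≤ j := by push_cast; linarith
            exact_mod_cast this
          · have : (j : ℝ) ≤ ((⌊v x⌋ + (2 * σ + 2) : ℤ) : ℝ) := by push_cast; linarith
            exact_mod_cast this
  · have hs' : (σ : ℝ) ≤ A * (Z + 1) := by
      have := (not_le.1 hs).le
      exact_mod_cast this
    set B : ℤ := (2 * A + 2) * (Z + 1) with hB
    have hB0 : 0 ≤ B := by positivity
    have hBr : (B : ℝ) = (2 * A + 2) * (Z + 1) := by rw [hB]; push_cast; ring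
    -- The strongest obstacle depends on the realisation. Recording its position as `m`, in a window
    -- of size `B`, lets the union bound treat it as a fixed index.
    obtain ⟨j, hj, hmax⟩ := Finset.exists_max_image (Finset.Icc (⌊v x⌋ - B) (⌊v x⌋ + B)) l
      ⟨⌊v x⌋, Finset.mem_Icc.2 ⟨by linarith, by linarith⟩⟩
    rw [Finset.mem_Icc] at hj
    refine ⟨j - ⌊v x⌋, abs_le.2 ⟨by linarith, by linarith⟩, ?_⟩
    simp only [chargedNodes, chargeWeight, hs, if_false, Finset.sum_singleton]
    rw [add_sub_cancel, one_mul]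
    calc ∑ k ∈ s, l k * volume.real (visitSet δ t v k)
        ≤ ∑ k ∈ s, l j * volume.real (visitSet δ t v k) := by
          refine Finset.sum_le_sum fun k _ => ?_
          by_cases h0 : volume.real (visitSet δ t v k) = 0
          · rw [h0, mul_zero, mul_zero]
          · refine mul_le_mul_of_nonneg_right (hmax k ?_) measureReal_nonneg
            have h1 := abs_le.1 (hnode k h0)
            have h2 : (σ : ℝ) + 1 + C * Z + 2 ≤ B := by rw [hBr]; nlinarith
            rw [Finset.mem_Icc]
            constructor
            · have : ((⌊v x⌋ - B : ℤ) : ℝ) ≤ k := by push_cast; linarith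
              exact_mod_cast this
            · have : (k : ℝ) ≤ ((⌊v x⌋ + B : ℤ) : ℝ) := by push_cast; linarith
              exact_mod_cast this
      _ = l j * ∑ k ∈ s, volume.real (visitSet δ t v k) := by rw [Finset.mul_sum]
      _ ≤ l j := mul_le_of_le_one_right (hl j) (sum_volume_visitSet_le hv hδ0 hδ s)

/-! ### Obstacle force along a graph -/

theorem IsObstacleProfile.eq_zero {δ : ℝ} {φ : ℝ × ℝ → ℝ} (hφ : IsObstacleProfile δ φ)
    {z : ℝ × ℝ} (h : δ < |z.1| ∨ δ < |z.2|) : φ z = 0 := by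
  by_contra h0
  have := hφ.support_subset h0
  rw [obstacleSquare, mem_prod, mem_Icc, mem_Icc, ← abs_le, ← abs_le] at this
  rcases h with h | h
  · linarith [this.1]
  · linarith [this.2]

theorem IsObstacleProfile.exists_bound {δ : ℝ} {φ : ℝ × ℝ → ℝ} (hφ : IsObstacleProfile δ φ) :
    ∃ M : ℝ, 1 ≤ M ∧ ∀ z, φ z ≤ M := by
  obtain ⟨C, hC⟩ := (isCompact_Icc.prod isCompact_Icc : IsCompact (obstacleSquare δ)).exists_bound_of_continuousOn
    hφ.smooth.continuous.continuousOn
  refine ⟨max C 1, le_max_right _ _, fun z => ?_⟩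
  by_cases hz : φ z = 0
  · rw [hz]; exact zero_le_one.trans (le_max_right _ _)
  · exact (le_abs_self _).trans ((hC z (hφ.support_subset hz)).trans (le_max_left _ _))

/-- The strength of the obstacles charged to the path with heights `H`, curvatures `Z` and
distinguished obstacles `m`. -/
noncomputable def pathCharge (A : ℕ) (I : Finset ℤ) (H : ℤ → ℤ) (Z : ℤ → ℕ) (m : ℤ → ℤ)
    (l : ℤ × ℤ → ℝ) : ℝ :=
  ∑ i ∈ I, ∑ j ∈ chargedNodes A (Z i) (H (i + 1) - H (i - 1)).natAbs (H i) (m i),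
    chargeWeight A (Z i) (H (i + 1) - H (i - 1)).natAbs * l (i, j)

theorem integral_profile_le {δ M : ℝ} {φ : ℝ × ℝ → ℝ} (hφ : IsObstacleProfile δ φ)
    (hM0 : 0 ≤ M) (hM : ∀ z, φ z ≤ M) {w : ℝ → ℝ} (hw : Continuous w) {a : ℝ} (ha : 0 ≤ a)
    (p : ℤ × ℤ) :
    ∫ y in (-a)..a, φ ((y, w y) - latticeNode p) ≤ M * volume.real (visitSet δ p.1 w p.2) := by
  have hmeas := (isClosed_visitSet (δ := δ) (t := p.1) hw p.2).measurableSet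
  have hint : Integrable ((visitSet δ p.1 w p.2).indicator fun _ => M) :=
    (integrable_indicator_iff hmeas).2 (integrableOn_const volume_visitSet_ne_top)
  calc ∫ y in (-a)..a, φ ((y, w y) - latticeNode p)
      ≤ ∫ y in (-a)..a, (visitSet δ p.1 w p.2).indicator (fun _ => M) y := by
        refine intervalIntegral.integral_mono (by linarith) ?_ hint.intervalIntegrable fun y => ?_
        · apply Continuous.intervalIntegrable
          exact hφ.smooth.continuous.comp ((continuous_id.prodMk hw).sub continuous_const)
        · by_cases h : y ∈ visitSet δ p.1 w p.2
          · rw [indicator_of_mem h]; exact hM _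
          · rw [indicator_of_notMem h]
            refine (hφ.eq_zero ?_).le
            simp only [latticeNode, Prod.fst_sub, Prod.snd_sub]
            by_contra! hc
            refine h ⟨?_, hc.2⟩
            have := abs_le.1 hc.1
            exact ⟨by linarith, by linarith⟩
    _ = ∫ y in Ioc (-a) a, (visitSet δ p.1 w p.2).indicator (fun _ => M) y :=
        intervalIntegral.integral_of_le (by linarith)
    _ ≤ ∫ y, (visitSet δ p.1 w p.2).indicator (fun _ => M) y :=
        setIntegral_le_integral hint (Eventually.of_forall fun y => indicator_nonneg (fun _ _ => hM0) y)
    _ = M * volume.real (visitSet δ p.1 w p.2) := by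
        rw [integral_indicator hmeas, setIntegral_const, smul_eq_mul, mul_comm]

/-- Trimming the interval by `δ` leaves columns `±N` touching it at most at its endpoints, so only
the `2 * N - 1` inner columns act. -/
theorem integral_profile_eq_zero {δ : ℝ} {φ : ℝ × ℝ → ℝ} (hφ : IsObstacleProfile δ φ)
    {w : ℝ → ℝ} {N : ℕ} (hδ : δ < N) {p : ℤ × ℤ} (hp : p.1 ∉ Finset.Ioo (-(N : ℤ)) N) :
    ∫ y in (-((N : ℝ) - δ))..((N : ℝ) - δ), φ ((y, w y) - latticeNode p) = 0 := by
  rw [intervalIntegral.integral_of_le (by linarith), integral_Ioc_eq_integral_Ioo]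
  refine setIntegral_eq_zero_of_forall_eq_zero fun y hy => hφ.eq_zero (Or.inl ?_)
  simp only [latticeNode, Prod.fst_sub]
  rw [Finset.mem_Ioo, not_and_or, not_lt, not_lt] at hp
  rcases hp with hp | hp
  · have : (p.1 : ℝ) ≤ -N := by exact_mod_cast hp
    exact lt_of_lt_of_le (by linarith [hy.1]) (le_abs_self _)
  · have : (N : ℝ) ≤ p.1 := by exact_mod_cast hp
    exact lt_of_lt_of_le (by linarith [hy.2]) (neg_le_abs _)

theorem integral_field_le {δ M : ℝ} {φ : ℝ × ℝ → ℝ} (hφ : IsObstacleProfile δ φ)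
    (hM0 : 0 ≤ M) (hM : ∀ z, φ z ≤ M) {w : ℝ → ℝ} (hw : Continuous w) {N : ℕ} (hδ : δ < N)
    {l : ℤ × ℤ → ℝ} (hl : ∀ p, 0 ≤ l p) (s : Finset ℤ) :
    ∫ y in (-((N : ℝ) - δ))..((N : ℝ) - δ), ∑ p ∈ Finset.Icc (-(N : ℤ)) N ×ˢ s,
        l p * φ ((y, w y) - latticeNode p) ≤
      M * ∑ i ∈ Finset.Ioo (-(N : ℤ)) N, ∑ j ∈ s, l (i, j) * volume.real (visitSet δ i w j) := by
  have hc : ∀ p, Continuous fun y => φ ((y, w y) - latticeNode p) := fun p =>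
    hφ.smooth.continuous.comp ((continuous_id.prodMk hw).sub continuous_const)
  have hint : ∀ p, IntervalIntegrable (fun y => l p * φ ((y, w y) - latticeNode p)) volume
      (-((N : ℝ) - δ)) ((N : ℝ) - δ) := fun p =>
    (continuous_const.mul (hc p)).intervalIntegrable _ _
  rw [intervalIntegral.integral_finsetSum fun p _ => hint p]
  simp only [intervalIntegral.integral_const_mul]
  rw [Finset.sum_product, Finset.mul_sum]
  rw [← Finset.sum_subset (Finset.Ioo_subset_Icc_self (a := -(N : ℤ)) (b := N))]
  · refine Finset.sum_le_sum fun i _ => ?_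
    rw [Finset.mul_sum]
    refine Finset.sum_le_sum fun j _ => ?_
    rw [mul_left_comm]
    exact mul_le_mul_of_nonneg_left
      (integral_profile_le hφ hM0 hM hw (by linarith) (i, j)) (hl _)
  · intro i _ hi
    exact Finset.sum_eq_zero fun j _ => by
      rw [integral_profile_eq_zero hφ hδ (p := (i, j)) hi, mul_zero]

/-- Green's formula at the midpoint for `z ^ 2 / 2`, whose second derivative is one. -/
theorem integral_tent_weight {a : ℝ} (ha : 0 < a) :
    ∫ z in (-a)..a, (a - |z|) / (2 * a) = a / 2 := by
  have h := three_point (v := fun z => z ^ 2 / 2) (v' := fun z => z) (q := fun _ => 1)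
    (fun x => ((hasDerivAt_pow 2 x).div_const 2).congr_deriv (by simp)) hasDerivAt_id
    continuous_const (p := -a) (m := 0) (r := a) (by linarith) ha.le
  have ht : ∀ z, tent (-a) 0 a z * 1 = (2 * a ^ 2) * ((a - |z|) / (2 * a)) := fun z => by
    have : (2 * a ^ 2) * ((a - |z|) / (2 * a)) = a * (a - |z|) := by field_simp
    rw [this]
    unfold tent
    rcases abs_cases z with hz | hz
    · rw [min_eq_right (by nlinarith), hz.1]; ring
    · rw [min_eq_left (by nlinarith), hz.1]; ring
  simp only [ht] at h
  rw [intervalIntegral.integral_const_mul] at h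
  have h2 : (2 * a ^ 2) * (a / 2) = (2 * a ^ 2) * ∫ z in (-a)..a, (a - |z|) / (2 * a) := by
    rw [← h]; ring
  exact (mul_left_cancel₀ (by positivity) h2).symm

/-- The grid `i * η` with `η = (N - δ) / N` sends `±N` to the endpoints and drifts from the integers
by at most `δ`. Hence column `i` contains its grid point and keeps distance `1 - 2 * δ` from both
neighbouring ones, which supplies the `c` of `abs_secant_sub_le`. -/
theorem column_mem {δ : ℝ} (hδ0 : 0 < δ) (hδ : δ < 1 / 2) {N : ℕ} (hN : 1 ≤ N) {i : ℤ}
    (hi : i ∈ Finset.Ioo (-(N : ℤ)) N) :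
    (i : ℝ) * ((N - δ) / N) - (N - δ) / N + (1 - 2 * δ) ≤ i - δ ∧
      (i : ℝ) + δ ≤ i * ((N - δ) / N) + (N - δ) / N - (1 - 2 * δ) ∧
      (i : ℝ) * ((N - δ) / N) ∈ Icc ((i : ℝ) - δ) (i + δ) ∧
      -((N : ℝ) - δ) ≤ i - δ ∧ (i : ℝ) + δ ≤ N - δ ∧
      -((N : ℝ) - δ) ≤ i * ((N - δ) / N) - (N - δ) / N ∧
      (i : ℝ) * ((N - δ) / N) + (N - δ) / N ≤ N - δ := by
  rw [Finset.mem_Ioo] at hi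
  have hi1 : (1 : ℝ) - N ≤ i := by
    have : (1 : ℤ) - N ≤ i := by omega
    exact_mod_cast this
  have hi2 : (i : ℝ) ≤ N - 1 := by
    have : i ≤ (N : ℤ) - 1 := by omega
    exact_mod_cast this
  have hN0 : (0 : ℝ) < N := by exact_mod_cast hN
  obtain ⟨k, hk⟩ : ∃ k, k = δ / N := ⟨_, rfl⟩
  have hk0 : 0 < k := by rw [hk]; positivity
  have hkN : N * k = δ := by rw [hk]; field_simp
  have hη : ((N : ℝ) - δ) / N = 1 - k := by rw [hk]; field_simp
  rw [hη]
  have e1 : 0 ≤ k * (N + i - 1) := mul_nonneg hk0.le (by linarith)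
  have e2 : 0 ≤ k * (N - 1 - i) := mul_nonneg hk0.le (by linarith)
  have hk1 : k ≤ 1 := by
    have : (1 : ℝ) ≤ N := by exact_mod_cast hN
    nlinarith
  have e3 : 0 ≤ (1 - k) * (N + i - 1) := mul_nonneg (by linarith) (by linarith)
  have e4 : 0 ≤ (1 - k) * (N - 1 - i) := mul_nonneg (by linarith) (by linarith)
  refine ⟨?_, ?_, ⟨?_, ?_⟩, ?_, ?_, ?_, ?_⟩ <;> nlinarith

theorem abs_floor_second_difference_le {x y z A : ℝ} (h : |x - 2 * y + z| ≤ A) {n : ℕ}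
    (hA : A ≤ n) : |⌊x⌋ - 2 * ⌊y⌋ + ⌊z⌋| ≤ (n : ℤ) + 2 := by
  have hx := Int.floor_le x
  have hx' := Int.lt_floor_add_one x
  have hy := Int.floor_le y
  have hy' := Int.lt_floor_add_one y
  have hz := Int.floor_le z
  have hz' := Int.lt_floor_add_one z
  have h' := abs_le.1 h
  rw [abs_le]
  constructor
  · have : ((-((n : ℤ) + 2) : ℤ) : ℝ) ≤ ((⌊x⌋ - 2 * ⌊y⌋ + ⌊z⌋ : ℤ) : ℝ) := by
      push_cast; linarith
    exact_mod_cast this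
  · have : ((⌊x⌋ - 2 * ⌊y⌋ + ⌊z⌋ : ℤ) : ℝ) ≤ (((n : ℤ) + 2 : ℤ) : ℝ) := by
      push_cast; linarith
    exact_mod_cast this

theorem abs_abs_sub_natAbs_floor_le (x z : ℝ) :
    |(|x - z| - ((⌊x⌋ - ⌊z⌋).natAbs : ℝ))| ≤ 1 := by
  rw [Nat.cast_natAbs, Int.cast_abs]
  refine (abs_abs_sub_abs_le_abs_sub _ _).trans ?_
  have hx := Int.floor_le x
  have hx' := Int.lt_floor_add_one x
  have hz := Int.floor_le z
  have hz' := Int.lt_floor_add_one z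
  rw [abs_le]; push_cast; constructor <;> linarith

/-! ### From a dipping solution to a discrete path -/

/-- A solution which dips below the tent leaves a discrete trace: integer heights `H` with
curvature bounds `Z`, along which the obstacles are exceptionally strong. -/
theorem exists_charged_path {δ M F : ℝ} {φ g : ℝ × ℝ → ℝ} {l : ℤ × ℤ → ℝ} {A N : ℕ}
    (hδ0 : 0 < δ) (hδ : δ < 1 / 2) (hφ : IsObstacleProfile δ φ) (hM1 : 1 ≤ M)
    (hM : ∀ z, φ z ≤ M) (hA : 2 * (1 + 4 / (1 - 2 * δ)) ≤ A) (hN : 1 ≤ N)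
    (hl : ∀ p, 0 ≤ l p) (hg : Continuous g) (hg0 : ∀ z, 0 ≤ g z) (hF : 0 ≤ F) {u : ℝ → ℝ}
    (hu : IsDirichletSolution (obstacleField φ g l) F (-(N : ℝ) + δ) ((N : ℝ) - δ) u) {x₀ : ℝ}
    (hx₀ : x₀ ∈ Icc (-(N : ℝ) + δ) ((N : ℝ) - δ))
    (hviol : u x₀ < max (((N : ℝ) - 1) - |x₀|) 0) :
    ∃ (H : ℤ → ℤ) (Z : ℤ → ℕ) (m : ℤ → ℤ),
      (∀ i ∉ Finset.Ioo (-(N : ℤ)) N, H i = 0) ∧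
      (∀ i ∈ Finset.Ioo (-(N : ℤ)) N, |H (i + 1) - 2 * H i + H (i - 1)| ≤ (Z i : ℤ) + 2) ∧
      (∀ i ∈ Finset.Ioo (-(N : ℤ)) N, |m i| ≤ (2 * A + 2) * ((Z i : ℤ) + 1)) ∧
      ∑ i ∈ Finset.Ioo (-(N : ℤ)) N, ((N : ℝ) - |(i : ℝ)|) / (2 * N) * Z i + (F - 13) * N ≤
        8 * (M * pathCharge A (Finset.Ioo (-(N : ℤ)) N) H Z m l) := by
  have hN1 : (1 : ℝ) ≤ N := by exact_mod_cast hN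
  rw [show -(N : ℝ) + δ = -((N : ℝ) - δ) by ring] at hu hx₀
  obtain ⟨a, ha⟩ : ∃ a, a = (N : ℝ) - δ := ⟨_, rfl⟩
  obtain ⟨η, hη⟩ : ∃ η, η = a / N := ⟨_, rfl⟩
  have ha0 : 0 < a := by linarith
  have hηN : N * η = a := by rw [hη]; field_simp
  have hη1 : η ≤ 1 := by rw [hη, div_le_one (by linarith)]; linarith
  have hη2 : 1 / 2 ≤ η := by rw [hη, le_div_iff₀ (by linarith)]; linarith
  have hcol := fun i hi => column_mem hδ0 hδ hN (i := i) hi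
  rw [← ha, ← hη] at hcol
  rw [← ha] at hu hx₀
  obtain ⟨hucont, hu2, hueq, hul, hur⟩ := hu
  -- continuous extension of the solution by its boundary values
  set w : ℝ → ℝ := IccExtend (show -a ≤ a by linarith) ((Icc (-a) a).domRestrict u) with hw
  have hwc : Continuous w := (continuousOn_iff_continuous_domRestrict.1 hucont).Icc_extend'
  have hwu : ∀ y ∈ Icc (-a) a, w y = u y := fun y hy => by
    rw [hw, IccExtend_of_mem _ _ hy]; rfl
  have hw_l : ∀ y ≤ -a, w y = 0 := fun y hy => by
    rw [hw, IccExtend_of_le_left _ _ hy]; exact hul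
  have hw_r : ∀ y, a ≤ y → w y = 0 := fun y hy => by
    rw [hw, IccExtend_of_right_le _ _ hy]; exact hur
  obtain ⟨B, hB⟩ := isCompact_Icc.exists_bound_of_continuousOn hucont
  -- The solution is bounded, so only finitely many rows matter and the obstacle force is a finite
  -- sum of continuous functions.
  set s : Finset ℤ := Finset.Icc (-(⌈B⌉ + 1)) (⌈B⌉ + 1) with hs
  set R : ℝ → ℝ := fun y =>
    ∑ p ∈ Finset.Icc (-(N : ℤ)) N ×ˢ s, l p * φ ((y, w y) - latticeNode p) with hR
  set P : ℝ → ℝ := fun y => F + g (y, w y) with hP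
  have hRc : Continuous R := continuous_finsetSum _ fun p _ => continuous_const.mul
    (hφ.smooth.continuous.comp ((continuous_id.prodMk hwc).sub continuous_const))
  have hPc : Continuous P := continuous_const.add (hg.comp (continuous_id.prodMk hwc))
  have hR0 : ∀ z, 0 ≤ R z := fun z =>
    Finset.sum_nonneg fun p _ => mul_nonneg (hl p) (hφ.nonneg _)
  have hP0 : ∀ z, 0 ≤ P z := fun z => add_nonneg hF (hg0 _)
  have hfield : ∀ y ∈ Icc (-a) a, obstacleField φ g l y (u y) + F = P y - R y := by
    intro y hy
    have : ∑' p : ℤ × ℤ, l p * φ ((y, u y) - latticeNode p) = R y := by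
      rw [hR]
      simp only [hwu y hy]
      refine tsum_eq_sum fun p hp => ?_
      rw [hφ.eq_zero, mul_zero]
      simp only [latticeNode, Prod.fst_sub, Prod.snd_sub]
      rw [Finset.mem_product, not_and_or, Finset.mem_Icc, hs, Finset.mem_Icc, not_and_or,
        not_and_or] at hp
      have hBy := abs_le.1 (hB y hy)
      have hBc := Int.le_ceil B
      rcases hp with (hp | hp) | (hp | hp)
      · left
        have : (p.1 : ℝ) + 1 ≤ -N := by
          have : p.1 + 1 ≤ -(N : ℤ) := by omega
          exact_mod_cast this
        exact lt_of_lt_of_le (by linarith [hy.1]) (le_abs_self _)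
      · left
        have : (N : ℝ) + 1 ≤ p.1 := by
          have : (N : ℤ) + 1 ≤ p.1 := by omega
          exact_mod_cast this
        exact lt_of_lt_of_le (by linarith [hy.2]) (neg_le_abs _)
      · right
        have : (p.2 : ℝ) + 1 ≤ -(⌈B⌉ + 1) := by
          have : p.2 + 1 ≤ -(⌈B⌉ + 1) := by omega
          exact_mod_cast this
        exact lt_of_lt_of_le (by linarith) (le_abs_self _)
      · right
        have : (⌈B⌉ : ℝ) + 1 + 1 ≤ p.2 := by
          have : ⌈B⌉ + 1 + 1 ≤ p.2 := by omega
          exact_mod_cast this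
        exact lt_of_lt_of_le (by linarith) (neg_le_abs _)
    rw [obstacleField, this, hP]
    simp only [hwu y hy]
    ring
  obtain ⟨v, v', hv, hv', huv⟩ := exists_global_primitive (q := fun x => R x - P x)
    (show -a < a by linarith) hucont hu2 (hRc.sub hPc) fun x hx => by
      linarith [hueq x hx, hfield x (Ioo_subset_Icc_self hx)]
  have hwv : ∀ y ∈ Icc (-a) a, w y = v y := fun y hy => (hwu y hy).trans (huv y hy)
  have hqQ : ∀ z, |R z - P z| ≤ P z + R z := fun z => by
    rw [abs_le]; constructor <;> linarith [hR0 z, hP0 z]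
  have hQc : Continuous fun z => P z + R z := hPc.add hRc
  have hQ0 : ∀ z, 0 ≤ P z + R z := fun z => add_nonneg (hP0 z) (hR0 z)
  -- the masses
  have hx₀a : |x₀| ≤ a := abs_le.2 hx₀
  have hviol' : u x₀ < a - |x₀| :=
    hviol.trans_le (max_le (by linarith) (by linarith))
  have hx₀a' : |x₀| < a := by
    refine lt_of_le_of_ne hx₀a fun h => ?_
    rw [h, sub_self] at hviol'
    rcases eq_or_eq_neg_of_abs_eq h with h' | h'
    · rw [h', hur] at hviol'; exact lt_irrefl _ hviol'
    · rw [h', hul] at hviol'; exact lt_irrefl _ hviol'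
  obtain ⟨T, hT⟩ : ∃ T, T = ∫ z in (-a)..a, R z := ⟨_, rfl⟩
  have hmass := weighted_mass_le hPc hRc hP0 hR0 hv hv' hx₀a'
    ((huv _ ⟨le_rfl, by linarith⟩).symm.trans hul) ((huv _ ⟨by linarith, le_rfl⟩).symm.trans hur)
    (by rw [← huv x₀ hx₀]; exact hviol')
  rw [← hT] at hmass
  have hρc : Continuous fun z : ℝ => (a - |z|) / (2 * a) := by fun_prop
  have hρ0 : ∀ z ∈ Icc (-a) a, 0 ≤ (a - |z|) / (2 * a) := fun z hz =>
    div_nonneg (by linarith [abs_le.2 hz]) (by linarith)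
  have hρ1 : ∀ z ∈ Icc (-a) a, (a - |z|) / (2 * a) ≤ 1 := fun z hz => by
    rw [div_le_one (by linarith)]; linarith [abs_nonneg z]
  have hFT : F * (a / 2) ≤ T + 2 := by
    refine le_trans ?_ hmass
    rw [← integral_tent_weight ha0, ← intervalIntegral.integral_const_mul]
    refine intervalIntegral.integral_mono_on (by linarith)
      ((continuous_const.mul hρc).intervalIntegrable _ _)
      ((hρc.mul hPc).intervalIntegrable _ _) fun z hz => ?_
    rw [mul_comm]
    exact mul_le_mul_of_nonneg_left (by linarith [hg0 (z, w z)]) (hρ0 z hz)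
  have hQT : ∫ z in (-a)..a, (a - |z|) / (2 * a) * (P z + R z) ≤ 2 * T + 2 := by
    have : ∫ z in (-a)..a, (a - |z|) / (2 * a) * (P z + R z) =
        (∫ z in (-a)..a, (a - |z|) / (2 * a) * P z) +
          ∫ z in (-a)..a, (a - |z|) / (2 * a) * R z := by
      have i1 : IntervalIntegrable (fun z => (a - |z|) / (2 * a) * P z) volume (-a) a :=
        (hρc.mul hPc).intervalIntegrable _ _
      have i2 : IntervalIntegrable (fun z => (a - |z|) / (2 * a) * R z) volume (-a) a :=
        (hρc.mul hRc).intervalIntegrable _ _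
      rw [← intervalIntegral.integral_add i1 i2]
      simp only [mul_add]
    have h2 : ∫ z in (-a)..a, (a - |z|) / (2 * a) * R z ≤ T := by
      rw [hT]
      exact intervalIntegral.integral_mono_on (by linarith) ((hρc.mul hRc).intervalIntegrable _ _)
        (hRc.intervalIntegrable _ _) fun z hz => mul_le_of_le_one_left (hR0 z) (hρ1 z hz)
    linarith
  have hsum := sum_hatMass_le hQc hQ0 (by linarith : 0 < η) hη1 hN
  rw [hηN] at hsum
  set Am : ℤ → ℝ := fun i => hatMass (fun z => P z + R z) (i * η - η) (i * η + η) with hAm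
  set Z : ℤ → ℕ := fun i => ⌈Am i⌉₊ with hZ
  set H : ℤ → ℤ := fun i => ⌊w (i * η)⌋ with hH
  have hAm0 : ∀ i, 0 ≤ Am i := fun i => hatMass_nonneg hQ0 (by linarith)
  have hsucc : ∀ i : ℤ, ((i + 1 : ℤ) : ℝ) * η = i * η + η := fun i => by push_cast; ring
  have hpred : ∀ i : ℤ, ((i - 1 : ℤ) : ℝ) * η = i * η - η := fun i => by push_cast; ring
  have hcharge : ∀ i ∈ Finset.Ioo (-(N : ℤ)) N, ∃ m : ℤ, |m| ≤ (2 * A + 2) * ((Z i : ℤ) + 1) ∧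
      ∑ j ∈ s, l (i, j) * volume.real (visitSet δ i w j) ≤
        ∑ j ∈ chargedNodes A (Z i) (H (i + 1) - H (i - 1)).natAbs (H i) m,
          chargeWeight A (Z i) (H (i + 1) - H (i - 1)).natAbs * l (i, j) := by
    intro i hi
    obtain ⟨h1, h2, h3, h4, h5, h6, h7⟩ := hcol i hi
    refine column_charge (x := i * η) (A' := Am i) (C := 4 / (1 - 2 * δ)) (η := η)
      (S := w (i * η + η) - w (i * η - η)) hwc hδ0 hδ h3 hη2 hη1 ?_
      (div_nonneg (by norm_num) (by linarith)) (Nat.le_ceil _) rfl ?_ hA (fun j => hl _) s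
    · intro y hy y' hy' hyy
      rw [hwv y ⟨by linarith [hy.1], by linarith [hy.2]⟩,
        hwv y' ⟨by linarith [hy'.1], by linarith [hy'.2]⟩, hwv _ ⟨by linarith, h7⟩,
        hwv _ ⟨h6, by linarith⟩]
      have := abs_secant_sub_le hv hv' (hRc.sub hPc) hQc hqQ (p := i * η - η) (r := i * η + η)
        (c := 1 - 2 * δ) (by linarith) (by linarith) (by linarith [hy.1]) hyy
        (by linarith [hy'.2])
      rwa [show i * η + η - (i * η - η) = 2 * η by ring] at this
    · simp only [hH, hsucc, hpred]
      exact abs_abs_sub_natAbs_floor_le _ _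
  choose! m hm1 hm2 using hcharge
  refine ⟨H, Z, m, fun i hi => ?_, fun i hi => ?_, hm1, ?_⟩
  · rw [Finset.mem_Ioo, not_and_or, not_lt, not_lt] at hi
    simp only [hH]
    rcases hi with hi | hi
    · have : (i : ℝ) ≤ -N := by exact_mod_cast hi
      rw [hw_l _ (by nlinarith), Int.floor_zero]
    · have : (N : ℝ) ≤ i := by exact_mod_cast hi
      rw [hw_r _ (by nlinarith), Int.floor_zero]
  · obtain ⟨-, -, h3, h4, h5, h6, h7⟩ := hcol i hi
    simp only [hH, hsucc, hpred]
    refine abs_floor_second_difference_le (A := Am i) ?_ (Nat.le_ceil _)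
    rw [hwv _ ⟨by linarith, h7⟩, hwv _ ⟨h6, by linarith⟩,
      hwv _ ⟨by linarith [h3.1], by linarith [h3.2]⟩]
    exact abs_second_difference_le hv hv' (hRc.sub hPc) hQc hqQ (by linarith)
  · have hTle : T ≤ M * pathCharge A (Finset.Ioo (-(N : ℤ)) N) H Z m l := by
      have := integral_field_le hφ (by linarith) hM hwc (N := N) (by linarith) hl s
      rw [← ha] at this
      rw [hT]
      refine this.trans (mul_le_mul_of_nonneg_left ?_ (by linarith))
      exact Finset.sum_le_sum hm2
    have hZsum : ∑ i ∈ Finset.Ioo (-(N : ℤ)) N, ((N : ℝ) - |(i : ℝ)|) / (2 * N) * Z i ≤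
        ∑ i ∈ Finset.Ioo (-(N : ℤ)) N, (((N : ℝ) - |(i : ℝ)|) / (2 * N) * Am i + 1 / 2) := by
      refine Finset.sum_le_sum fun i hi => ?_
      have h1 : (Z i : ℝ) ≤ Am i + 1 := (Nat.ceil_lt_add_one (hAm0 i)).le
      rw [Finset.mem_Ioo] at hi
      have h2 : |(i : ℝ)| ≤ N := by
        rw [abs_le]
        exact ⟨by exact_mod_cast hi.1.le, by exact_mod_cast hi.2.le⟩
      have h3 : ((N : ℝ) - |(i : ℝ)|) / (2 * N) ≤ 1 / 2 := by
        rw [div_le_div_iff₀ (by linarith) (by norm_num)]; linarith [abs_nonneg (i : ℝ)]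
      have h4 : 0 ≤ ((N : ℝ) - |(i : ℝ)|) / (2 * N) := div_nonneg (by linarith) (by linarith)
      nlinarith
    rw [Finset.sum_add_distrib, Finset.sum_const, Int.card_Ioo, nsmul_eq_mul] at hZsum
    have hcard : (((N : ℤ) - -(N : ℤ) - 1).toNat : ℝ) ≤ 2 * N := by
      have : ((N : ℤ) - -(N : ℤ) - 1).toNat ≤ 2 * N := by omega
      exact_mod_cast this
    -- Constants: `∑ ρ Z ≤ 4 * T + 4 + N`, the last term from rounding up, and `F * N ≤ 4 * (T +
    -- 2)`. Together these give `8 * T + 12 + N ≤ 8 * T + 13 * N`.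
    have haF : F * N ≤ 4 * (F * (a / 2)) := by nlinarith
    nlinarith

/-! ### Exponential moments of the obstacle strengths -/

theorem IsIIDExponential.ae_pos {Ω : Type*} [MeasurableSpace Ω] {P : Measure Ω}
    [IsProbabilityMeasure P] {lam : ℝ} {l : ℤ × ℤ → Ω → ℝ} (h : IsIIDExponential P lam l)
    (p : ℤ × ℤ) : ∀ᵐ ω ∂P, 0 < l p ω := by
  have h1 := h.tail p 0 le_rfl
  rw [mul_zero, Real.exp_zero, ENNReal.ofReal_one] at h1
  exact (prob_compl_eq_zero_iff (measurableSet_lt measurable_const (h.measurable p))).2 h1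

/-- The layer-cake formula gives `1 + c / (lam - c)`, and `c ≤ lam / 2` bounds the fraction by `2 *
c / lam`. -/
theorem IsIIDExponential.lintegral_exp_le {Ω : Type*} [MeasurableSpace Ω] {P : Measure Ω}
    [IsProbabilityMeasure P] {lam : ℝ} (hlam : 0 < lam) {l : ℤ × ℤ → Ω → ℝ}
    (h : IsIIDExponential P lam l) (p : ℤ × ℤ) {c : ℝ} (hc : 0 ≤ c) (hc2 : c ≤ lam / 2) :
    ∫⁻ ω, ENNReal.ofReal (Real.exp (c * l p ω)) ∂P ≤ ENNReal.ofReal (Real.exp (2 * c / lam)) := by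
  have hcont : Continuous fun t : ℝ => c * Real.exp (c * t) := by fun_prop
  have hprim : ∀ x, ∫ t in (0 : ℝ)..x, c * Real.exp (c * t) = Real.exp (c * x) - 1 := fun x => by
    have hd : ∀ t, HasDerivAt (fun t => Real.exp (c * t)) (c * Real.exp (c * t)) t := fun t =>
      (((hasDerivAt_id t).const_mul c).exp).congr_deriv (by simp; ring)
    rw [intervalIntegral.integral_eq_sub_of_hasDerivAt (fun t _ => hd t)
      (hcont.intervalIntegrable _ _)]
    simp
  have hlc := lintegral_comp_eq_lintegral_meas_lt_mul P (f := l p)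
    (g := fun t => c * Real.exp (c * t)) ((h.ae_pos p).mono fun _ hx => hx.le)
    (h.measurable p).aemeasurable (fun t _ => hcont.intervalIntegrable _ _)
    (Eventually.of_forall fun t => by positivity)
  simp only [hprim] at hlc
  have hneg : c - lam < 0 := by linarith
  have hr : ∫⁻ t in Ioi (0 : ℝ), P {ω | t < l p ω} * ENNReal.ofReal (c * Real.exp (c * t)) =
      ENNReal.ofReal (c / (lam - c)) := by
    have : ∫⁻ t in Ioi (0 : ℝ), P {ω | t < l p ω} * ENNReal.ofReal (c * Real.exp (c * t)) =
        ∫⁻ t in Ioi (0 : ℝ), ENNReal.ofReal (c * Real.exp ((c - lam) * t)) := by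
      refine setLIntegral_congr_fun measurableSet_Ioi fun t ht => ?_
      rw [h.tail p t (le_of_lt ht), ← ENNReal.ofReal_mul (Real.exp_pos _).le]
      congr 1
      rw [mul_left_comm, ← Real.exp_add]
      ring_nf
    rw [this, ← ofReal_integral_eq_lintegral_ofReal
      ((integrableOn_exp_mul_Ioi hneg 0).const_mul c)
      (Eventually.of_forall fun t => by positivity), integral_const_mul,
      integral_exp_mul_Ioi hneg]
    congr 1
    rw [mul_zero, Real.exp_zero, ← neg_sub lam c, neg_div_neg_eq, mul_one_div]
  rw [hr] at hlc
  have hcl : c / (lam - c) ≤ 2 * c / lam := by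
    rw [div_le_div_iff₀ (by linarith) hlam]; nlinarith
  calc ∫⁻ ω, ENNReal.ofReal (Real.exp (c * l p ω)) ∂P
      ≤ ∫⁻ ω, (ENNReal.ofReal (Real.exp (c * l p ω) - 1) + 1) ∂P := by
        refine lintegral_mono fun ω => ?_
        calc ENNReal.ofReal (Real.exp (c * l p ω))
            = ENNReal.ofReal (Real.exp (c * l p ω) - 1 + 1) := by rw [sub_add_cancel]
          _ ≤ _ := by
            refine ENNReal.ofReal_add_le.trans ?_
            rw [ENNReal.ofReal_one]
    _ = ENNReal.ofReal (c / (lam - c)) + 1 := by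
        rw [lintegral_add_right _ measurable_const, hlc]; simp
    _ = ENNReal.ofReal (c / (lam - c) + 1) := by
        rw [ENNReal.ofReal_add (div_nonneg hc (by linarith)) zero_le_one, ENNReal.ofReal_one]
    _ ≤ ENNReal.ofReal (Real.exp (2 * c / lam)) :=
        ENNReal.ofReal_le_ofReal ((add_le_add_left hcl 1).trans (Real.add_one_le_exp _))

theorem IsIIDExponential.measure_sum_ge_le {Ω : Type*} [MeasurableSpace Ω] {P : Measure Ω}
    [IsProbabilityMeasure P] {lam : ℝ} (hlam : 0 < lam) {l : ℤ × ℤ → Ω → ℝ}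
    (h : IsIIDExponential P lam l) (S : Finset (ℤ × ℤ)) {c : ℤ × ℤ → ℝ} (hc : ∀ p, 0 ≤ c p)
    (hc2 : ∀ p, c p ≤ lam / 2) (t : ℝ) :
    P {ω | t ≤ ∑ p ∈ S, c p * l p ω} ≤
      ENNReal.ofReal (Real.exp (2 / lam * ∑ p ∈ S, c p - t)) := by
  have hm : ∀ p, Measurable fun x : ℝ => ENNReal.ofReal (Real.exp (c p * x)) := fun p => by
    fun_prop
  have hind : iIndepFun (fun p ω => ENNReal.ofReal (Real.exp (c p * l p ω))) P :=
    h.indep.comp (fun p x => ENNReal.ofReal (Real.exp (c p * x))) hm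
  have hmeas : ∀ p, Measurable fun ω => ENNReal.ofReal (Real.exp (c p * l p ω)) := fun p =>
    (hm p).comp (h.measurable p)
  have hprod : ∀ ω, ∏ p ∈ S, ENNReal.ofReal (Real.exp (c p * l p ω)) =
      ENNReal.ofReal (Real.exp (∑ p ∈ S, c p * l p ω)) := fun ω => by
    rw [Real.exp_sum, ENNReal.ofReal_prod_of_nonneg fun p _ => (Real.exp_pos _).le]
  calc P {ω | t ≤ ∑ p ∈ S, c p * l p ω}
      ≤ P {ω | ENNReal.ofReal (Real.exp t) ≤ ∏ p ∈ S, ENNReal.ofReal (Real.exp (c p * l p ω))} := by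
        refine measure_mono fun ω hω => ?_
        simp only [mem_ofPred_eq, hprod] at hω ⊢
        exact ENNReal.ofReal_le_ofReal (Real.exp_le_exp.2 hω)
    _ ≤ (∫⁻ ω, ∏ p ∈ S, ENNReal.ofReal (Real.exp (c p * l p ω)) ∂P) /
          ENNReal.ofReal (Real.exp t) :=
        meas_ge_le_lintegral_div (Finset.measurable_prod _ fun p _ => hmeas p).aemeasurable
          (by simpa using Real.exp_pos t) ENNReal.ofReal_ne_top
    _ ≤ ENNReal.ofReal (Real.exp (2 / lam * ∑ p ∈ S, c p)) / ENNReal.ofReal (Real.exp t) := by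
        gcongr
        rw [lintegral_prod_eq_prod_lintegral_of_indepFun S _ hind hmeas]
        refine (Finset.prod_le_prod' fun p _ => h.lintegral_exp_le hlam p (hc p) (hc2 p)).trans ?_
        rw [← ENNReal.ofReal_prod_of_nonneg fun p _ => (Real.exp_pos _).le, ← Real.exp_sum,
          Finset.mul_sum]
        refine le_of_eq ?_
        congr 3 with p
        ring
    _ = _ := by
        rw [← ENNReal.ofReal_div_of_pos (Real.exp_pos t), ← Real.exp_sub]

/-- Chernoff's bound with parameter `lam / 8`: charge weights are at most `4`, so the exponents stay
below `lam / 2`. Total weight at most `36` per column yields `9` per column in the exponent. -/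
theorem IsIIDExponential.measure_pathCharge_ge_le {Ω : Type*} [MeasurableSpace Ω] {P : Measure Ω}
    [IsProbabilityMeasure P] {lam : ℝ} (hlam : 0 < lam) {l : ℤ × ℤ → Ω → ℝ}
    (h : IsIIDExponential P lam l) {A : ℕ} (hA : 1 ≤ A) {M : ℝ} (hM : 0 < M) (I : Finset ℤ)
    (H : ℤ → ℤ) (Z : ℤ → ℕ) (m : ℤ → ℤ) (B : ℝ) :
    P {ω | B ≤ 8 * (M * pathCharge A I H Z m fun p => l p ω)} ≤
      ENNReal.ofReal (Real.exp (9 * I.card - lam / (64 * M) * B)) := by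
  set K : ℤ → Finset ℤ := fun i =>
    chargedNodes A (Z i) (H (i + 1) - H (i - 1)).natAbs (H i) (m i) with hK
  set k : ℤ → ℝ := fun i => chargeWeight A (Z i) (H (i + 1) - H (i - 1)).natAbs with hk
  set S : Finset (ℤ × ℤ) := I.biUnion fun i => (K i).image (Prod.mk i) with hS
  have hmem : ∀ p : ℤ × ℤ, p ∈ S ↔ p.1 ∈ I ∧ p.2 ∈ K p.1 := by
    rintro ⟨i, j⟩
    simp only [hS, Finset.mem_biUnion, Finset.mem_image, Prod.mk.injEq]
    constructor
    · rintro ⟨i', hi', j', hj', rfl, rfl⟩; exact ⟨hi', hj'⟩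
    · rintro ⟨hi, hj⟩; exact ⟨i, hi, j, hj, rfl, rfl⟩
  have hsum : ∀ f : ℤ × ℤ → ℝ, ∑ p ∈ S, lam / 8 * k p.1 * f p =
      lam / 8 * ∑ i ∈ I, ∑ j ∈ K i, k i * f (i, j) := fun f => by
    rw [Finset.sum_finset_product S I K hmem, Finset.mul_sum]
    refine Finset.sum_congr rfl fun i _ => ?_
    rw [Finset.mul_sum]
    exact Finset.sum_congr rfl fun j _ => by ring
  have hmain := h.measure_sum_ge_le hlam S (c := fun p => lam / 8 * k p.1)
    (fun p => mul_nonneg (by positivity) (chargeWeight_nonneg _ _ _))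
    (fun p => by
      have : k p.1 ≤ 4 := chargeWeight_le hA
      nlinarith) (lam / (64 * M) * B)
  have htot : ∑ p ∈ S, lam / 8 * k p.1 ≤ lam / 8 * (36 * I.card) := by
    have := hsum fun _ => 1
    simp only [mul_one] at this
    rw [this]
    refine mul_le_mul_of_nonneg_left ?_ (by positivity)
    refine (Finset.sum_le_card_nsmul I _ 36 fun i _ => sum_chargeWeight_le hA _ _).trans ?_
    rw [nsmul_eq_mul, mul_comm]
  refine le_trans (measure_mono fun ω hω => ?_) (hmain.trans ?_)
  · simp only [mem_ofPred_eq] at hω ⊢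
    rw [hsum fun p => l p ω]
    change lam / (64 * M) * B ≤ lam / 8 * pathCharge A I H Z m fun p => l p ω
    have := mul_le_mul_of_nonneg_left hω (by positivity : 0 ≤ lam / (64 * M))
    refine this.trans (le_of_eq ?_)
    field_simp
    norm_num
  · refine ENNReal.ofReal_le_ofReal (Real.exp_le_exp.2 (sub_le_sub_right ?_ _))
    refine (mul_le_mul_of_nonneg_left htot (by positivity)).trans (le_of_eq ?_)
    field_simp
    ring

theorem measurable_pathCharge {Ω : Type*} [MeasurableSpace Ω] {l : ℤ × ℤ → Ω → ℝ}
    (hl : ∀ p, Measurable (l p)) (A : ℕ) (I : Finset ℤ) (H : ℤ → ℤ) (Z : ℤ → ℕ) (m : ℤ → ℤ) :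
    Measurable fun ω => pathCharge A I H Z m fun p => l p ω := by
  unfold pathCharge
  exact Finset.measurable_sum _ fun i _ => Finset.measurable_sum _ fun j _ => (hl _).const_mul _

/-! ### Counting discrete paths -/

theorem ENNReal.tsum_fin_pi_prod {α : Type*} {n : ℕ} (G : Fin n → α → ENNReal) :
    ∑' f : Fin n → α, ∏ i, G i (f i) = ∏ i, ∑' x, G i x := by
  induction n with
  | zero => simp
  | succ n ih =>
    rw [← (Fin.consEquiv fun _ => α).tsum_eq, Fin.prod_univ_succ]
    simp only [Fin.prod_univ_succ, Fin.consEquiv, Equiv.coe_fn_mk, Fin.cons_zero, Fin.cons_succ]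
    rw [ENNReal.tsum_prod (f := fun x (f : Fin n → α) => G 0 x * ∏ i : Fin n, G i.succ (f i))]
    simp only [ENNReal.tsum_mul_left]
    rw [ENNReal.tsum_mul_right, ih]

theorem ENNReal.tsum_pi_prod {ι α : Type*} [Fintype ι] (G : ι → α → ENNReal) :
    ∑' f : ι → α, ∏ i, G i (f i) = ∏ i, ∑' x, G i x := by
  have e := Fintype.equivFin ι
  rw [← (e.symm.arrowCongr (Equiv.refl α)).tsum_eq, ← e.symm.prod_comp,
    ← ENNReal.tsum_fin_pi_prod]
  refine tsum_congr fun f => ?_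
  rw [← e.symm.prod_comp]
  simp [Equiv.arrowCongr]

/-- Integer sequences vanishing outside `(-N, N)` are determined by their second differences. -/
theorem eq_of_second_difference_eq {N : ℕ} {H H' : ℤ → ℤ}
    (h0 : ∀ i ∉ Finset.Ioo (-(N : ℤ)) N, H i = 0) (h0' : ∀ i ∉ Finset.Ioo (-(N : ℤ)) N, H' i = 0)
    (h : ∀ i ∈ Finset.Ioo (-(N : ℤ)) N,
      H (i + 1) - 2 * H i + H (i - 1) = H' (i + 1) - 2 * H' i + H' (i - 1)) : H = H' := by
  rcases Nat.eq_zero_or_pos N with rfl | hN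
  · funext i; rw [h0 i (by simp), h0' i (by simp)]
  obtain ⟨e, he⟩ : ∃ e, e = H (-N + 1) - H' (-N + 1) := ⟨_, rfl⟩
  have hb : ∀ i, i = -(N : ℤ) ∨ i = N → H i - H' i = 0 := fun i hi => by
    have : i ∉ Finset.Ioo (-(N : ℤ)) N := by rw [Finset.mem_Ioo]; omega
    rw [h0 i this, h0' i this, sub_self]
  -- The difference `H - H'` is linear in the distance from `-N`, with slope `e`; its vanishing at
  -- `N` then forces `e = 0`.
  have key : ∀ k : ℕ, k + 1 ≤ 2 * N → H (-N + k) - H' (-N + k) = k * e ∧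
      H (-N + (k + 1)) - H' (-N + (k + 1)) = (k + 1) * e := by
    intro k
    induction k with
    | zero => intro _; simp [he, hb]
    | succ k ih =>
      intro hk
      obtain ⟨h1, h2⟩ := ih (by omega)
      push_cast
      refine ⟨h2, ?_⟩
      have := h (-N + (k + 1)) (by rw [Finset.mem_Ioo]; omega)
      rw [show -(N : ℤ) + (k + 1) - 1 = -N + k by ring,
        show -(N : ℤ) + (k + 1) + 1 = -N + (k + 1 + 1) by ring] at this
      linarith
  have he0 : e = 0 := by
    obtain ⟨-, h2⟩ := key (2 * N - 1) (by omega)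
    have hc : ((2 * N - 1 : ℕ) : ℤ) = 2 * N - 1 := by omega
    rw [hc, show -(N : ℤ) + (2 * N - 1 + 1) = N by ring, hb N (Or.inr rfl)] at h2
    have : (2 * (N : ℤ)) * e = 0 := by linarith
    rcases mul_eq_zero.1 this with h3 | h3
    · omega
    · exact h3
  funext i
  by_cases hi : i ∈ Finset.Ioo (-(N : ℤ)) N
  · have hi' := Finset.mem_Ioo.1 hi
    obtain ⟨h1, -⟩ := key (i + N).toNat (by omega)
    have hc : (((i + N).toNat : ℕ) : ℤ) = i + N := by omega
    rw [hc, he0, mul_zero, show -(N : ℤ) + (i + N) = i by ring] at h1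
    linarith
  · rw [h0 i hi, h0' i hi]

/-- The weight of a step with curvature `x.1`, height increment `x.2.1` and distinguished
obstacle `x.2.2`. -/
noncomputable def stepWeight (b : ℕ) (β : ℝ) (x : ℕ × ℤ × ℤ) : ENNReal :=
  if |x.2.1| ≤ (x.1 : ℤ) + 2 ∧ |x.2.2| ≤ b * ((x.1 : ℤ) + 1) then
    ENNReal.ofReal (Real.exp (-(β * x.1))) else 0

/-- For curvature `n` there are at most `30 * b * (n + 2).choose 2` admissible pairs, and `∑ (n +
2).choose 2 * x ^ n = (1 - x)⁻³` with `x = exp (-β)`. -/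
theorem tsum_stepWeight_le {b : ℕ} (hb : 1 ≤ b) {β : ℝ} (hβ : 0 < β) :
    ∑' x, stepWeight b β x ≤ ENNReal.ofReal (30 * b * ((1 + β) / β) ^ 3) := by
  set x := Real.exp (-β) with hx
  have hx0 : 0 < x := Real.exp_pos _
  have hx1 : x ≤ 1 / (1 + β) := by
    rw [hx, Real.exp_neg, inv_eq_one_div]
    exact one_div_le_one_div_of_le (by linarith) (by linarith [Real.add_one_le_exp β])
  have hx2 : β / (1 + β) ≤ 1 - x := by
    have : β / (1 + β) = 1 - 1 / (1 + β) := by field_simp; ring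
    linarith
  have hx3 : 0 < β / (1 + β) := by positivity
  have hinner : ∀ n : ℕ, ∑' y : ℤ × ℤ, stepWeight b β (n, y) ≤
      ENNReal.ofReal (30 * b * (((n + 2).choose 2 : ℕ) * x ^ n)) := by
    intro n
    set s : Finset (ℤ × ℤ) := Finset.Icc (-((n : ℤ) + 2)) (n + 2) ×ˢ
      Finset.Icc (-(b * ((n : ℤ) + 1))) (b * (n + 1)) with hs
    have h1 : ∑' y : ℤ × ℤ, stepWeight b β (n, y) = ∑ y ∈ s, stepWeight b β (n, y) := by
      refine tsum_eq_sum fun y hy => ?_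
      unfold stepWeight
      rw [if_neg]
      rintro ⟨ha, hb⟩
      refine hy (Finset.mem_product.2 ⟨Finset.mem_Icc.2 ?_, Finset.mem_Icc.2 ?_⟩)
      · exact abs_le.1 ha
      · exact abs_le.1 hb
    have h2 : ∀ y ∈ s, stepWeight b β (n, y) ≤ ENNReal.ofReal (x ^ n) := fun y _ => by
      unfold stepWeight
      have : Real.exp (-(β * n)) = x ^ n := by
        rw [hx, ← Real.exp_nat_mul]; ring_nf
      split_ifs
      · simp only [this]; exact le_rfl
      · exact zero_le
    rw [h1]
    refine (Finset.sum_le_card_nsmul s _ _ h2).trans ?_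
    rw [nsmul_eq_mul, ← ENNReal.ofReal_natCast, ← ENNReal.ofReal_mul (Nat.cast_nonneg _)]
    refine ENNReal.ofReal_le_ofReal ?_
    rw [← mul_assoc]
    refine mul_le_mul_of_nonneg_right ?_ (by positivity)
    have hcard : s.card = (2 * n + 5) * (2 * (b * (n + 1)) + 1) := by
      rw [hs, Finset.card_product, Int.card_Icc, Int.card_Icc]
      have e : (b : ℤ) * ((n : ℤ) + 1) = ((b * (n + 1) : ℕ) : ℤ) := by push_cast; ring
      rw [e]
      congr 1; all_goals omega
    have hch : (((n + 2).choose 2 : ℕ) : ℝ) = ((n : ℝ) + 2) * (n + 1) / 2 := by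
      rw [Nat.cast_choose_two]; push_cast; ring
    have hb1 : (1 : ℝ) ≤ b := by exact_mod_cast hb
    have hn0 : (0 : ℝ) ≤ n := Nat.cast_nonneg n
    rw [hcard, hch]
    push_cast
    have h3 : 2 * ((b : ℝ) * (n + 1)) + 1 ≤ 3 * (b * (n + 1)) := by nlinarith
    calc (2 * (n : ℝ) + 5) * (2 * (b * (n + 1)) + 1)
        ≤ (5 * (n + 2)) * (3 * (b * (n + 1))) := by
          gcongr; linarith
      _ = 30 * b * ((n + 2) * (n + 1) / 2) := by ring
  have hnorm : ‖x‖ < 1 := by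
    rw [Real.norm_eq_abs, abs_of_pos hx0]; linarith
  have hsummable := (summable_choose_mul_geometric_of_norm_lt_one 2 hnorm).mul_left (30 * (b : ℝ))
  calc ∑' x, stepWeight b β x = ∑' (n : ℕ) (y : ℤ × ℤ), stepWeight b β (n, y) :=
        ENNReal.tsum_prod (f := fun n y => stepWeight b β (n, y))
    _ ≤ ∑' n : ℕ, ENNReal.ofReal (30 * b * (((n + 2).choose 2 : ℕ) * x ^ n)) :=
        ENNReal.tsum_le_tsum hinner
    _ = ENNReal.ofReal (30 * b * (1 / (1 - x) ^ 3)) := by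
        rw [← ENNReal.ofReal_tsum_of_nonneg (fun n => by positivity) hsummable, tsum_mul_left,
          tsum_choose_mul_geometric_of_norm_lt_one 2 hnorm]
    _ ≤ ENNReal.ofReal (30 * b * ((1 + β) / β) ^ 3) := by
        refine ENNReal.ofReal_le_ofReal (mul_le_mul_of_nonneg_left ?_ (by positivity))
        rw [← one_div_pow]
        refine pow_le_pow_left₀ (one_div_nonneg.2 (by linarith)) ?_ 3
        rw [← one_div_div β]
        exact one_div_le_one_div_of_le hx3 hx2

theorem prod_Ioo_natAbs_le {f : ℕ → ℝ} (n : ℕ) (hf : ∀ k < n, 1 ≤ f k) :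
    ∏ i ∈ Finset.Ioo (-(n : ℤ)) n, f i.natAbs ≤ (∏ k ∈ Finset.range n, f k) ^ 2 := by
  induction n with
  | zero => simp
  | succ n ih =>
    have hn := hf n (Nat.lt_succ_self n)
    have ih := ih fun k hk => hf k (hk.trans (Nat.lt_succ_self n))
    rw [Finset.prod_range_succ, mul_pow]
    rcases Nat.eq_zero_or_pos n with rfl | hn0
    · have : Finset.Ioo (-((0 + 1 : ℕ) : ℤ)) ((0 + 1 : ℕ) : ℤ) = {0} := by decide
      rw [this]
      simp only [Finset.prod_singleton, Int.natAbs_zero, Finset.range_zero, Finset.prod_empty]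
      nlinarith
    · have hI : Finset.Ioo (-((n + 1 : ℕ) : ℤ)) ((n + 1 : ℕ) : ℤ) =
          insert (n : ℤ) (insert (-(n : ℤ)) (Finset.Ioo (-(n : ℤ)) (n : ℤ))) := by
        ext i; simp only [Finset.mem_Ioo, Finset.mem_insert]; omega
      rw [hI, Finset.prod_insert, Finset.prod_insert]
      · simp only [Int.natAbs_natCast, Int.natAbs_neg]
        nlinarith [sq_nonneg (f n)]
      · simp
      · simp only [Finset.mem_insert, Finset.mem_Ioo]; omega

/-- Pairing `i` with `-i` bounds the product by `((2 * N) ^ N / N!) ^ 2`, which is exponential in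
`N`. The column `0` is counted twice, harmlessly, as its factor is at least one. -/
theorem prod_inv_weight_le (N : ℕ) :
    ∏ i ∈ Finset.Ioo (-(N : ℤ)) N, (2 * (N : ℝ)) / (N - |(i : ℝ)|) ≤ Real.exp (4 * N) := by
  have h1 : ∏ i ∈ Finset.Ioo (-(N : ℤ)) N, (2 * (N : ℝ)) / (N - |(i : ℝ)|) =
      ∏ i ∈ Finset.Ioo (-(N : ℤ)) N, (fun k : ℕ => (2 * (N : ℝ)) / (N - k)) i.natAbs :=
    Finset.prod_congr rfl fun i _ => by simp only [Nat.cast_natAbs, Int.cast_abs]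
  have h2 : ∏ k ∈ Finset.range N, (2 * (N : ℝ)) / (N - k) = (2 * N) ^ N / (N.factorial : ℝ) := by
    rw [Finset.prod_div_distrib, Finset.prod_const, Finset.card_range]
    congr 1
    rw [← Finset.prod_range_add_one_eq_factorial, Nat.cast_prod, ← Finset.prod_range_reflect]
    refine Finset.prod_congr rfl fun k hk => ?_
    have := Finset.mem_range.1 hk
    rw [show N - 1 - k = N - (k + 1) by omega, Nat.cast_sub this, sub_sub_cancel]
  rw [h1]
  refine (prod_Ioo_natAbs_le (f := fun k : ℕ => (2 * (N : ℝ)) / (N - k)) N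
    fun k hk => ?_).trans ?_
  · have : (k : ℝ) < N := by exact_mod_cast hk
    rw [le_div_iff₀ (by linarith)]
    linarith [Nat.cast_nonneg (α := ℝ) k]
  · rw [h2]
    calc ((2 * (N : ℝ)) ^ N / (N.factorial : ℝ)) ^ 2 ≤ Real.exp (2 * N) ^ 2 :=
          pow_le_pow_left₀ (by positivity) (Real.pow_div_factorial_le_exp (2 * (N : ℝ)) (by positivity) N) 2
      _ = Real.exp (4 * N) := by rw [← Real.exp_nat_mul]; ring_nf

/-- The data of a discrete path at the columns in `I`, extended by zero: the curvature bound, the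
height and the distinguished obstacle. -/
noncomputable def pathExtend {I : Finset ℤ} (ξ : I → ℕ × ℤ × ℤ) (i : ℤ) : ℕ × ℤ × ℤ :=
  if h : i ∈ I then ξ ⟨i, h⟩ else 0

theorem pathExtend_of_mem {I : Finset ℤ} (ξ : I → ℕ × ℤ × ℤ) {i : ℤ} (h : i ∈ I) :
    pathExtend ξ i = ξ ⟨i, h⟩ := dif_pos h

theorem pathExtend_of_notMem {I : Finset ℤ} (ξ : I → ℕ × ℤ × ℤ) {i : ℤ} (h : i ∉ I) :
    pathExtend ξ i = 0 := dif_neg h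

/-- The steps of a discrete path: its heights are replaced by their second differences. -/
noncomputable def pathStep {I : Finset ℤ} (ξ : I → ℕ × ℤ × ℤ) (i : I) : ℕ × ℤ × ℤ :=
  ((ξ i).1, (pathExtend ξ (i + 1)).2.1 - 2 * (pathExtend ξ i).2.1 + (pathExtend ξ (i - 1)).2.1,
    (ξ i).2.2)

theorem pathStep_injective (N : ℕ) :
    Function.Injective (pathStep (I := Finset.Ioo (-(N : ℤ)) N)) := by
  intro ξ ξ' h
  have hi : ∀ i, pathStep ξ i = pathStep ξ' i := fun i => congrFun h i
  simp only [pathStep, Prod.mk.injEq] at hi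
  have hH := eq_of_second_difference_eq (N := N) (H := fun i => (pathExtend ξ i).2.1)
    (H' := fun i => (pathExtend ξ' i).2.1) (fun i h => by simp [pathExtend_of_notMem _ h])
    (fun i h => by simp [pathExtend_of_notMem _ h]) (fun i h => (hi ⟨i, h⟩).2.1)
  funext i
  have h2 := congrFun hH i
  simp only [pathExtend_of_mem _ i.2] at h2
  exact Prod.ext (hi i).1 (Prod.ext h2 (hi i).2.2)

/-! ### Union bound over discrete paths -/

/-- The event that the obstacles along the path `ξ` have total strength at least `B`, up to the
energy of the path. -/
def strongPathEvent {Ω : Type*} (l : ℤ × ℤ → Ω → ℝ) (A : ℕ) (M : ℝ) (N : ℕ) (B : ℝ)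
    (ξ : Finset.Ioo (-(N : ℤ)) N → ℕ × ℤ × ℤ) : Set Ω :=
  {ω | (∀ i, |(pathStep ξ i).2.1| ≤ ((pathStep ξ i).1 : ℤ) + 2 ∧
      |(pathStep ξ i).2.2| ≤ (2 * A + 2 : ℕ) * (((pathStep ξ i).1 : ℤ) + 1)) ∧
    ∑ i ∈ Finset.Ioo (-(N : ℤ)) N, ((N : ℝ) - |(i : ℝ)|) / (2 * N) * (pathExtend ξ i).1 + B ≤
      8 * (M * pathCharge A (Finset.Ioo (-(N : ℤ)) N) (fun i => (pathExtend ξ i).2.1)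
        (fun i => (pathExtend ξ i).1) (fun i => (pathExtend ξ i).2.2) fun p => l p ω)}

theorem measurableSet_strongPathEvent {Ω : Type*} [MeasurableSpace Ω] {l : ℤ × ℤ → Ω → ℝ}
    (hl : ∀ p, Measurable (l p)) (A : ℕ) (M : ℝ) (N : ℕ) (B : ℝ)
    (ξ : Finset.Ioo (-(N : ℤ)) N → ℕ × ℤ × ℤ) :
    MeasurableSet (strongPathEvent l A M N B ξ) :=
  (MeasurableSet.const _).inter (measurableSet_le measurable_const
    (((measurable_pathCharge hl _ _ _ _ _).const_mul _).const_mul _))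

/-- The energy in the threshold becomes a product over columns, so the sum over paths can be
factorised. Admissibility does not depend on `ω`: inadmissible paths give the empty event. -/
theorem measure_strongPathEvent_le {Ω : Type*} [MeasurableSpace Ω] {P : Measure Ω}
    [IsProbabilityMeasure P] {lam : ℝ} (hlam : 0 < lam) {l : ℤ × ℤ → Ω → ℝ}
    (h : IsIIDExponential P lam l) {A : ℕ} (hA : 1 ≤ A) {M : ℝ} (hM : 0 < M) (N : ℕ) (B : ℝ)
    (ξ : Finset.Ioo (-(N : ℤ)) N → ℕ × ℤ × ℤ) :
    P (strongPathEvent l A M N B ξ) ≤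
      ENNReal.ofReal (Real.exp (18 * N - lam / (64 * M) * B)) *
        ∏ i : Finset.Ioo (-(N : ℤ)) N, stepWeight (2 * A + 2)
          (lam / (64 * M) * (((N : ℝ) - |((i : ℤ) : ℝ)|) / (2 * N))) (pathStep ξ i) := by
  by_cases hadm : ∀ i, |(pathStep ξ i).2.1| ≤ ((pathStep ξ i).1 : ℤ) + 2 ∧
      |(pathStep ξ i).2.2| ≤ (2 * A + 2 : ℕ) * (((pathStep ξ i).1 : ℤ) + 1)
  · have hprod : ∏ i : Finset.Ioo (-(N : ℤ)) N, stepWeight (2 * A + 2)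
        (lam / (64 * M) * (((N : ℝ) - |((i : ℤ) : ℝ)|) / (2 * N))) (pathStep ξ i) =
        ENNReal.ofReal (Real.exp (-(lam / (64 * M) * ∑ i ∈ Finset.Ioo (-(N : ℤ)) N,
          ((N : ℝ) - |(i : ℝ)|) / (2 * N) * (pathExtend ξ i).1))) := by
      rw [Finset.mul_sum, ← Finset.sum_neg_distrib, Real.exp_sum,
        ENNReal.ofReal_prod_of_nonneg fun i _ => (Real.exp_pos _).le,
        ← Finset.prod_coe_sort (Finset.Ioo (-(N : ℤ)) N)]
      refine Finset.prod_congr rfl fun i _ => ?_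
      rw [stepWeight, if_pos (hadm i), pathExtend_of_mem ξ i.2, mul_assoc]
      rfl
    rw [hprod, ← ENNReal.ofReal_mul (Real.exp_pos _).le, ← Real.exp_add]
    refine (measure_mono fun ω hω => hω.2).trans
      ((h.measure_pathCharge_ge_le hlam hA hM _ _ _ _ _).trans ?_)
    refine ENNReal.ofReal_le_ofReal (Real.exp_le_exp.2 ?_)
    have hcard : ((Finset.Ioo (-(N : ℤ)) N).card : ℝ) ≤ 2 * N := by
      rw [Int.card_Ioo]
      have : ((N : ℤ) - -(N : ℤ) - 1).toNat ≤ 2 * N := by omega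
      exact_mod_cast this
    rw [mul_add]
    linarith
  · have : strongPathEvent l A M N B ξ = ∅ := eq_empty_of_forall_notMem fun ω hω => hadm hω.1
    rw [this, measure_empty]
    exact zero_le

/-- Injectivity of `pathStep` allows summing over independent steps instead of paths. The rate `30`
is `18` from Chernoff plus `3 * 4` from the cubed inverse weights; `D` to the number of columns
gives `2 * Real.log D`. -/
theorem measure_iUnion_strongPathEvent_le {Ω : Type*} [MeasurableSpace Ω] {P : Measure Ω}
    [IsProbabilityMeasure P] {lam : ℝ} (hlam : 0 < lam) {l : ℤ × ℤ → Ω → ℝ}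
    (h : IsIIDExponential P lam l) {A : ℕ} (hA : 1 ≤ A) {M : ℝ} (hM : 0 < M) {N : ℕ} (B : ℝ)
    {γ D : ℝ} (hγ : γ = lam / (64 * M))
    (hD : D = 30 * (2 * A + 2 : ℕ) * ((1 + γ) / γ) ^ 3) :
    P (⋃ ξ, strongPathEvent l A M N B ξ) ≤
      ENNReal.ofReal (Real.exp ((30 + 2 * Real.log D) * N - γ * B)) := by
  have hγ0 : 0 < γ := by rw [hγ]; positivity
  have hD1 : 1 ≤ D := by
    have h1 : 1 ≤ (1 + γ) / γ := by rw [le_div_iff₀ hγ0]; linarith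
    have h2 : (1 : ℝ) ≤ (2 * A + 2 : ℕ) := by push_cast; linarith [Nat.cast_nonneg (α := ℝ) A]
    have h3 : 1 ≤ ((1 + γ) / γ) ^ 3 := one_le_pow₀ h1
    rw [hD]; nlinarith
  set G : Finset.Ioo (-(N : ℤ)) N → ℕ × ℤ × ℤ → ENNReal := fun i =>
    stepWeight (2 * A + 2) (γ * (((N : ℝ) - |(i : ℝ)|) / (2 * N))) with hG
  have hstep : ∀ i, ∑' x, G i x ≤ ENNReal.ofReal (D * ((2 * (N : ℝ)) / (N - |(i : ℝ)|)) ^ 3) := by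
    intro i
    have hi := Finset.mem_Ioo.1 i.2
    have hi1 : |((i : ℤ) : ℝ)| < N := by
      rw [abs_lt]; exact ⟨by exact_mod_cast hi.1, by exact_mod_cast hi.2⟩
    obtain ⟨ρ, hρ⟩ : ∃ ρ, ρ = ((N : ℝ) - |(i : ℝ)|) / (2 * N) := ⟨_, rfl⟩
    have hN0 : (0 : ℝ) < N := (abs_nonneg _).trans_lt hi1
    have hρ0 : 0 < ρ := by rw [hρ]; exact div_pos (by linarith) (by linarith)
    have hρ1 : ρ ≤ 1 := by
      rw [hρ, div_le_one (by linarith)]; linarith [abs_nonneg ((i : ℤ) : ℝ)]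
    refine (tsum_stepWeight_le (by omega) ?_).trans (ENNReal.ofReal_le_ofReal ?_)
    · rw [← hρ]; positivity
    -- As `ρ ≤ 1`, the factor `(1 + γ * ρ) / (γ * ρ)` is at most `(1 + γ) / γ * (1 / ρ)`, separating
    -- the constant from the degenerating weight.
    · rw [← hρ, hD, mul_assoc _ (_ ^ 3) (_ ^ 3), ← mul_pow]
      have : 2 * (N : ℝ) / (N - |(i : ℝ)|) = 1 / ρ := by rw [hρ, one_div_div]
      rw [this]
      refine mul_le_mul_of_nonneg_left (pow_le_pow_left₀ (by positivity) ?_ 3) (by positivity)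
      rw [div_mul_div_comm, mul_one]
      gcongr
      nlinarith
  calc P (⋃ ξ, strongPathEvent l A M N B ξ)
      ≤ ∑' ξ, P (strongPathEvent l A M N B ξ) := measure_iUnion_le _
    _ ≤ ∑' ξ, ENNReal.ofReal (Real.exp (18 * N - γ * B)) * ∏ i, G i (pathStep ξ i) := by
        refine ENNReal.tsum_le_tsum fun ξ => ?_
        have := measure_strongPathEvent_le hlam h hA hM N B ξ
        rwa [← hγ] at this
    _ = ENNReal.ofReal (Real.exp (18 * N - γ * B)) * ∑' ξ, ∏ i, G i (pathStep ξ i) :=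
        ENNReal.tsum_mul_left
    _ ≤ ENNReal.ofReal (Real.exp (18 * N - γ * B)) *
          ∑' D : Finset.Ioo (-(N : ℤ)) N → ℕ × ℤ × ℤ, ∏ i, G i (D i) := by
        refine mul_le_mul' le_rfl ?_
        exact ENNReal.tsum_comp_le_tsum_of_injective (pathStep_injective N)
          fun D => ∏ i, G i (D i)
    _ ≤ ENNReal.ofReal (Real.exp (18 * N - γ * B)) * ENNReal.ofReal
          (∏ i : Finset.Ioo (-(N : ℤ)) N, D * ((2 * (N : ℝ)) / (N - |(i : ℝ)|)) ^ 3) := by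
        refine mul_le_mul' le_rfl ?_
        rw [ENNReal.tsum_pi_prod, ENNReal.ofReal_prod_of_nonneg]
        · exact Finset.prod_le_prod' fun i _ => hstep i
        · intro i _
          have hi := Finset.mem_Ioo.1 i.2
          have hi1 : |((i : ℤ) : ℝ)| < N := by
            rw [abs_lt]; exact ⟨by exact_mod_cast hi.1, by exact_mod_cast hi.2⟩
          exact mul_nonneg (by linarith)
            (pow_nonneg (div_nonneg (by positivity) (by linarith)) 3)
    _ ≤ ENNReal.ofReal (Real.exp (18 * N - γ * B)) *
          ENNReal.ofReal (Real.exp (2 * Real.log D * N) * Real.exp (4 * N) ^ 3) := by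
        gcongr
        rw [Finset.prod_coe_sort (Finset.Ioo (-(N : ℤ)) N)
          fun i : ℤ => D * ((2 * (N : ℝ)) / (N - |(i : ℝ)|)) ^ 3, Finset.prod_mul_distrib,
          Finset.prod_const, Finset.prod_pow]
        refine mul_le_mul ?_ (pow_le_pow_left₀ ?_ (prod_inv_weight_le N) 3) ?_ (Real.exp_pos _).le
        · have hcard : (Finset.Ioo (-(N : ℤ)) N).card ≤ 2 * N := by
            rw [Int.card_Ioo]; omega
          refine (pow_le_pow_right₀ hD1 hcard).trans (le_of_eq ?_)
          rw [show 2 * Real.log D * N = ((2 * N : ℕ) : ℝ) * Real.log D by push_cast; ring,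
            Real.exp_nat_mul, Real.exp_log (by linarith)]
        · refine Finset.prod_nonneg fun i hi => ?_
          have hi := Finset.mem_Ioo.1 hi
          have hi1 : |(i : ℝ)| < N := by
            rw [abs_lt]; exact ⟨by exact_mod_cast hi.1, by exact_mod_cast hi.2⟩
          exact div_nonneg (by positivity) (by linarith)
        · refine pow_nonneg (Finset.prod_nonneg fun i hi => ?_) 3
          have hi := Finset.mem_Ioo.1 hi
          have hi1 : |(i : ℝ)| < N := by
            rw [abs_lt]; exact ⟨by exact_mod_cast hi.1, by exact_mod_cast hi.2⟩
          exact div_nonneg (by positivity) (by linarith)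
    _ = ENNReal.ofReal (Real.exp ((30 + 2 * Real.log D) * N - γ * B)) := by
        rw [← ENNReal.ofReal_mul (Real.exp_pos _).le, ← Real.exp_nat_mul, ← Real.exp_add,
          ← Real.exp_add]
        congr 2
        push_cast; ring

/-! ### Conclusion -/

theorem pathCharge_congr {A : ℕ} {I : Finset ℤ} {H H' : ℤ → ℤ} {Z Z' : ℤ → ℕ} {m m' : ℤ → ℤ}
    (hH : ∀ i, H i = H' i) (hZ : ∀ i ∈ I, Z i = Z' i) (hm : ∀ i ∈ I, m i = m' i)
    (l : ℤ × ℤ → ℝ) : pathCharge A I H Z m l = pathCharge A I H' Z' m' l := by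
  obtain rfl : H = H' := funext hH
  unfold pathCharge
  refine Finset.sum_congr rfl fun i hi => ?_
  rw [hZ i hi, hm i hi]

theorem theorem2p1 (δ : ℝ) (hδ : 0 < δ) (hδ' : δ < 1 / 2) (lam : ℝ) (hlam : 0 < lam)
    (φ : ℝ × ℝ → ℝ) (hφ : IsObstacleProfile δ φ) :
    ∃ F₀ > (0 : ℝ), ∃ C > (0 : ℝ), ∃ K > (0 : ℝ), ∃ N₀ : ℕ,
      ∀ (Ω : Type*) [MeasurableSpace Ω] (P : Measure Ω) [IsProbabilityMeasure P]
        (l : ℤ × ℤ → Ω → ℝ) (g : Ω → ℝ × ℝ → ℝ),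
        IsIIDExponential P lam l → IsCompensator P φ l g →
        ∀ F : ℝ, F₀ < F → ∀ N : ℕ, N₀ ≤ N →
          ∃ E : Set Ω, MeasurableSet E ∧ 1 - C * Real.exp (-((N : ℝ) / C)) ≤ P.real E ∧
            ∀ ω ∈ E, ∀ u : ℝ → ℝ,
              IsDirichletSolution (obstacleField φ (g ω) (fun p => l p ω)) F
                (-(N : ℝ) + δ) ((N : ℝ) - δ) u →
              ∀ x ∈ Icc (-(N : ℝ) + δ) ((N : ℝ) - δ),
                max (K * ((N : ℝ) - 1) - K * |x|) 0 ≤ u x := by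
  obtain ⟨M, hM1, hM⟩ := hφ.exists_bound
  obtain ⟨A, hA⟩ := exists_nat_ge (2 * (1 + 4 / (1 - 2 * δ)))
  have hA1 : 1 ≤ A := by
    have : (1 : ℝ) ≤ A := by
      have : 0 ≤ 4 / (1 - 2 * δ) := div_nonneg (by norm_num) (by linarith)
      linarith
    exact_mod_cast this
  obtain ⟨γ, hγ⟩ : ∃ γ, γ = lam / (64 * M) := ⟨_, rfl⟩
  obtain ⟨D, hD⟩ : ∃ D : ℝ, D = 30 * (2 * A + 2 : ℕ) * ((1 + γ) / γ) ^ 3 := ⟨_, rfl⟩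
  have hγ0 : 0 < γ := by rw [hγ]; positivity
  have hF₀ : 0 ≤ (31 + 2 * |Real.log D|) / γ := by positivity
  -- This `F₀` makes `γ * (F - 13)` exceed the entropy rate `30 + 2 * Real.log D` by at least one,
  -- leaving probability at most `exp (-N)`; hence `C = 1`.
  refine ⟨13 + (31 + 2 * |Real.log D|) / γ, by linarith, 1, one_pos, 1, one_pos, 1,
    fun Ω _ P _ l g hl hg F hF N hN => ?_⟩
  set bad : Set Ω := ⋃ ξ, strongPathEvent l A M N ((F - 13) * N) ξ with hbad
  have hbadm : MeasurableSet bad :=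
    MeasurableSet.iUnion fun ξ => measurableSet_strongPathEvent hl.measurable _ _ _ _ ξ
  have hposm : MeasurableSet {ω | ∀ p, 0 ≤ l p ω} := by
    rw [ofPred_forall]
    exact MeasurableSet.iInter fun p => measurableSet_le measurable_const (hl.measurable p)
  have hpos : ∀ᵐ ω ∂P, ∀ p, 0 ≤ l p ω := ae_all_iff.2 fun p => (hl.ae_pos p).mono fun _ h => h.le
  refine ⟨{ω | ∀ p, 0 ≤ l p ω} ∩ badᶜ, hposm.inter hbadm.compl, ?_, ?_⟩
  · have hP : P.real bad ≤ Real.exp (-N) := by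
      refine ENNReal.toReal_le_of_le_ofReal (Real.exp_pos _).le
        ((measure_iUnion_strongPathEvent_le hlam hl hA1 (by linarith) _ hγ hD).trans
          (ENNReal.ofReal_le_ofReal (Real.exp_le_exp.2 ?_)))
      have h1 : 31 + 2 * |Real.log D| ≤ γ * (F - 13) := by
        have : (31 + 2 * |Real.log D|) / γ ≤ F - 13 := by linarith
        rw [div_le_iff₀ hγ0] at this
        linarith
      have h2 := le_abs_self (Real.log D)
      have hN0 : (0 : ℝ) ≤ N := Nat.cast_nonneg N
      have h3 : 0 ≤ (γ * (F - 13) - 31 - 2 * Real.log D) * N :=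
        mul_nonneg (by linarith) hN0
      linarith
    have hE : P.real ({ω | ∀ p, 0 ≤ l p ω} ∩ badᶜ) = P.real badᶜ := by
      refine measureReal_congr ?_
      filter_upwards [hpos] with ω hω
      exact propext ⟨fun h => h.2, fun h => ⟨hω, h⟩⟩
    rw [hE, probReal_compl_eq_one_sub hbadm, div_one, one_mul]
    linarith
  · rintro ω ⟨hlω, hω⟩ u hu x hx
    by_contra hlt
    rw [not_le, one_mul, one_mul] at hlt
    obtain ⟨H, Z, m, hH, hd, hm, hsum⟩ := exists_charged_path hδ hδ' hφ hM1 hM hA hN hlω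
      (hg.contDiff ω).continuous (hg.nonneg ω) (by linarith) hu hx hlt
    refine hω (mem_iUnion.2 ⟨fun i => (Z i, H i, m i), ?_⟩)
    set ξ : Finset.Ioo (-(N : ℤ)) N → ℕ × ℤ × ℤ := fun i => (Z i, H i, m i) with hξ
    have eH : ∀ i, (pathExtend ξ i).2.1 = H i := fun i => by
      by_cases hi : i ∈ Finset.Ioo (-(N : ℤ)) N
      · rw [pathExtend_of_mem ξ hi]
      · rw [pathExtend_of_notMem ξ hi, hH i hi]; rfl
    have eZ : ∀ i ∈ Finset.Ioo (-(N : ℤ)) N, (pathExtend ξ i).1 = Z i := fun i hi => by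
      rw [pathExtend_of_mem ξ hi]
    have em : ∀ i ∈ Finset.Ioo (-(N : ℤ)) N, (pathExtend ξ i).2.2 = m i := fun i hi => by
      rw [pathExtend_of_mem ξ hi]
    refine ⟨fun i => ?_, ?_⟩
    · simp only [pathStep, eH]
      exact ⟨hd i i.2, by push_cast; exact hm i i.2⟩
    · rw [pathCharge_congr eH eZ em]
      refine le_trans (le_of_eq ?_) hsum
      congr 1
      exact Finset.sum_congr rfl fun i hi => by rw [eZ i hi]
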